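/- Let $d\ge 2$, let $f$ be a probability density on $\mathbb{R}^d$, $c\in\mathbb{R}$, and let $\mathcal{M}=\{x\in\mathbb{R}^d: f(x)=c\}$ be compact. Let $\mathscr{H}$ denote the $(d-1)$-dimensional Hausdorff measure on $\mathbb{R}^d$, normalized to agree with Lebesgue measure on $(d-1)$-dimensional planes. Let $\nu\ge 2$ be an integer and assume the following. (F1) There are $\delta_0,\epsilon_0>0$ such that $f$ has continuous partial derivatives up to order $\nu$ on $\{x: |f(x)-c|\le 2\delta_0\}$ and $\|\nabla f(x)\|>\epsilon_0$ for all $x$ in this set. (K) $K:\mathbb{R}^d\to\mathbb{R}$ is twice continuously differentiable with bounded support, and is a kernel of order $\nu$: $\int_{\mathbb{R}^d} K(u)\,du=1$, $\int_{\mathbb{R}^d} u^{\otimes l}K(u)\,du=0$ for $l=1,\dots,\nu-1$, and $\int_{\mathbb{R}^d} u^{\otimes \nu}K(u)\,du\neq 0$. Let $X_1,X_2,\dots$ be i.i.d. with density $f$, let $h=h_n>0$ be bandwidths, and let $$\widehat f(x)=\frac{1}{nh^d}\sum_{i=1}^n K\Big(\frac{x-X_i}{h}\Big)$$ be the kernel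 density estimator. For $x\in\mathcal{M}$ let $\mathbf{N}(x)=\nabla f(x)/\|\nabla f(x)\|$, let $T_x=\{y\in\mathbb{R}^d:\langle y,\nabla f(x)\rangle=0\}$ be the tangent space of $\mathcal{M}$ at $x$, and for $t\in\mathbb{R}$ let $T_{x,t}=\{y+t\mathbf{N}(x): y\in T_x\}$. Put $$R_K(x)=\int_{\mathbb{R}}\Big(\int_{T_{x,t}}K(u)\,d\mathscr{H}(u)\Big)^2dt .$$ Let $w:\mathcal{M}\to\mathbb{R}$ be bounded and continuous. If $nh\to\infty$ and $h\to0$ as $n\to\infty$, then $$\sqrt{nh}\int_{\mathcal{M}} w(x)\,\big[\widehat f(x)-\mathbb{E}\widehat f(x)\big]\,d\mathscr{H}(x)\ \longrightarrow_D\ \mathscr{N}(0,\sigma^2),\qquad \sigma^2=c\int_{\mathcal{M}}w(x)^2R_K(x)\,d\mathscr{H}(x),$$ where all integrands are integrable, $0\le\sigma^2<\infty$, and $\mathscr{N}(0,0)$ is the point mass at $0$. -/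

import Mathlib

open MeasureTheory ProbabilityTheory Filter Topology

noncomputable section

namespace LevelSetKDE

/-- Euclidean space `ℝ^d`. -/
abbrev Eucl (d : ℕ) : Type := EuclideanSpace ℝ (Fin d)

/-- The `c`-level set of `f`. -/
def levelSet {d : ℕ} (f : Eucl d → ℝ) (c : ℝ) : Set (Eucl d) := f ⁻¹' {c}

/-- `f⁻¹([c - δ, c + δ])`. -/
def levelBand {d : ℕ} (f : Eucl d → ℝ) (c δ : ℝ) : Set (Eucl d) :=
  f ⁻¹' Set.Icc (c - δ) (c + δ)

/-- The surface integral of `g` over the `c`-level set of `f`, with respect to the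
`(d-1)`-dimensional Hausdorff measure normalized to agree with Lebesgue measure in dimension
`d - 1`. -/
def surfaceIntegral {d : ℕ} (f : Eucl d → ℝ) (c : ℝ) (g : Eucl d → ℝ) : ℝ :=
  ∫ x in levelSet f c, g x ∂μHE[d - 1]

/-- The entries of `∫ u^{⊗ l} K(u) du`, indexed by `i : Fin l → Fin d`. -/
def kernelMoment {d : ℕ} (K : Eucl d → ℝ) (l : ℕ) (i : Fin l → Fin d) : ℝ :=
  ∫ u : Eucl d, (∏ j, u (i j)) * K u

/-- `K` is a twice continuously differentiable kernel of order `ν ≥ 2` with bounded support. -/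
structure KernelAssumption {d : ℕ} (K : Eucl d → ℝ) (ν : ℕ) : Prop where
  two_le_order : 2 ≤ ν
  contDiff : ContDiff ℝ 2 K
  hasCompactSupport : HasCompactSupport K
  integral_eq_one : ∫ u, K u = 1
  moment_eq_zero : ∀ l : ℕ, 1 ≤ l → l < ν → kernelMoment K l = 0
  moment_ne_zero : kernelMoment K ν ≠ 0

/-- For some `δ₀, ε₀ > 0`, `f` has continuous partial derivatives up to order `ν` on
`f⁻¹([c - 2δ₀, c + 2δ₀])`, where its gradient has norm larger than `ε₀`. -/
def DensitySmoothness {d : ℕ} (f : Eucl d → ℝ) (c : ℝ) (ν : ℕ) : Prop :=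
  ∃ δ₀ > 0, ∃ ε₀ > 0, ∀ x ∈ levelBand f c (2 * δ₀),
    ContDiffAt ℝ (ν : WithTop ℕ∞) f x ∧ ε₀ < ‖gradient f x‖

/-- The normalized gradient. -/
def unitNormal {d : ℕ} (f : Eucl d → ℝ) (x : Eucl d) : Eucl d :=
  ‖gradient f x‖⁻¹ • gradient f x

/-- The tangent space at `x` (a linear subspace of `ℝ^d`) of the level set of `f` through `x`. -/
def tangentSpace {d : ℕ} (f : Eucl d → ℝ) (x : Eucl d) : Submodule ℝ (Eucl d) :=
  (ℝ ∙ gradient f x)ᗮ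

/-- The affine plane `{y + t N(x) : y ∈ T_x}`. -/
def tangentPlane {d : ℕ} (f : Eucl d → ℝ) (x : Eucl d) (t : ℝ) : Set (Eucl d) :=
  (fun y => y + t • unitNormal f x) '' (tangentSpace f x : Set (Eucl d))

/-- `R_K(x) = ∫ (∫_{T_{x,t}} K dℋ)² dt`. -/
def roughness {d : ℕ} (f K : Eucl d → ℝ) (x : Eucl d) : ℝ :=
  ∫ t : ℝ, (∫ u in tangentPlane f x t, K u ∂μHE[d - 1]) ^ 2

/-- The kernel density estimator at `x`, with bandwidth `h`, from the sample `X 0, …, X (n-1)`. -/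
def kde {d : ℕ} {Ω : Type*} (K : Eucl d → ℝ) (X : ℕ → Ω → Eucl d) (n : ℕ) (h : ℝ)
    (x : Eucl d) (ω : Ω) : ℝ :=
  1 / (n * h ^ d) * ∑ i ∈ Finset.range n, K (h⁻¹ • (x - X i ω))

end LevelSetKDE

end

/-!
Write `σ` for the Hausdorff measure on the level set `S`, of dimension `m = d - 1`, and
`G_h(y) = ∫ w(x) K((x - y)/h) dσ(x)`. By Fubini, the weighted surface integral of the centred
estimator is `(n h^d)⁻¹ ∑ i < n, (G_h(X_i) - 𝔼 G_h(X_i))`, the row sum of a triangular array with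
i.i.d. rows, so that only the size and the variance of `G_h(X_i)` matter.

The measure `σ` satisfies `σ(B(x, r)) ≤ A r^m`, hence `|G_h| ≤ B h^m`: after multiplication by
`√(n h)` the summands are at most a multiple of `(n h)^(-1/2)`, and Lindeberg's condition is
trivial. For the variance, `𝔼 G_h(X_i) = O(h^d)`, while `𝔼 G_h(X_i)²` is the integral of
`w(x) K((x - y)/h) G_h(y) f(y)` over `x ∈ S` and `y`. Substitute `y = x - h u`. Near `x` the level
set is nearly flat at scale `h`, so that `h^(-m) G_h(x - h u)` tends to the integral of `w(x) K`
over the translate by `u` of the tangent plane `T_x`. By dominated convergence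
`h^(-m-d) 𝔼 G_h(X_i)²` tends to the integral over `S` of `w² f` times the slice energy
`∫ K(u) ∫_{T_x} K(z + u) dz du`, and decomposing `u` along `T_x` and its normal turns the slice
energy into `R_K(x)`.
-/

noncomputable section

namespace LevelSetKDE

open Module (finrank)

/-! ### A central limit theorem for small bounded summands -/

lemma norm_cexp_mul_I_sub_le {x : ℝ} (hx : |x| ≤ 1) :
    ‖Complex.exp (x * Complex.I) - (1 + x * Complex.I - (x ^ 2 / 2 : ℝ))‖ ≤ |x| ^ 3 := by
  have hnorm : ‖(x : ℂ) * Complex.I‖ = |x| := by simp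
  have hbound := Complex.exp_bound (hnorm.trans_le hx) (n := 3) (by norm_num)
  have hsum : ∑ j ∈ Finset.range 3, ((x : ℂ) * Complex.I) ^ j / (j.factorial : ℂ)
      = 1 + x * Complex.I - (x ^ 2 / 2 : ℝ) := by
    simp [Finset.sum_range_succ, mul_pow, Nat.factorial]
    ring
  rw [hsum, hnorm] at hbound
  refine hbound.trans (mul_le_of_le_one_right (by positivity) ?_)
  norm_num [Nat.factorial]

section CharFun

variable {E : Type*} [MeasurableSpace E] {μ : Measure E}

lemma norm_charFun_map_sub_le [IsProbabilityMeasure μ] {g : E → ℝ}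
    (hg : Measurable g) {a : ℝ} (hga : ∀ y, |g y| ≤ a) (hmean : ∫ y, g y ∂μ = 0) {t : ℝ}
    (ht : |t| * a ≤ 1) :
    ‖charFun (μ.map g) t - (1 - (t ^ 2 / 2 * Var[g; μ] : ℝ))‖ ≤ |t| ^ 3 * a * Var[g; μ] := by
  have hint : Integrable g μ := .of_bound hg.aestronglyMeasurable a (ae_of_all _ hga)
  have hint_sq : Integrable (fun y => g y ^ 2) μ :=
    ((memLp_top_of_bound hg.aestronglyMeasurable a (ae_of_all _ hga)).mono_exponent
      le_top).integrable_sq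
  have hint_exp : Integrable (fun y => Complex.exp ((t * g y : ℝ) * Complex.I)) μ :=
    .of_bound (by fun_prop) 1 (ae_of_all _ fun y => (Complex.norm_exp_ofReal_mul_I _).le)
  have hint_lin : Integrable (fun y => ((t * g y : ℝ) : ℂ) * Complex.I) μ :=
    (hint.const_mul t).ofReal.mul_const _
  have hint_quad : Integrable (fun y => (((t * g y) ^ 2 / 2 : ℝ) : ℂ)) μ := by
    simp_rw [mul_pow, mul_div_right_comm]
    exact (hint_sq.const_mul _).ofReal
  have hvar : Var[g; μ] = ∫ y, g y ^ 2 ∂μ := variance_of_integral_eq_zero hg.aemeasurable hmean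
  have hremainder : charFun (μ.map g) t - (1 - (t ^ 2 / 2 * Var[g; μ] : ℝ))
      = ∫ y, (Complex.exp ((t * g y : ℝ) * Complex.I)
        - (1 + (t * g y : ℝ) * Complex.I - ((t * g y) ^ 2 / 2 : ℝ))) ∂μ := by
    have hint_affine : Integrable (fun y => 1 + ((t * g y : ℝ) : ℂ) * Complex.I) μ :=
      (integrable_const _).add hint_lin
    have hint_taylor : Integrable (fun y => 1 + ((t * g y : ℝ) : ℂ) * Complex.I
        - ((t * g y) ^ 2 / 2 : ℝ)) μ := hint_affine.sub hint_quad
    rw [integral_sub hint_exp hint_taylor, integral_sub hint_affine hint_quad,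
      integral_add (integrable_const _) hint_lin, integral_mul_const, integral_complex_ofReal,
      integral_complex_ofReal, integral_const_mul, hmean, charFun_apply_real,
      integral_map hg.aemeasurable (by fun_prop), hvar]
    simp_rw [mul_pow, mul_div_right_comm, integral_const_mul]
    simp
  rw [hremainder, hvar, ← integral_const_mul]
  refine norm_integral_le_of_norm_le (hint_sq.const_mul _) (ae_of_all _ fun y => ?_)
  have hsmall : |t * g y| ≤ 1 := by
    rw [abs_mul]
    exact (mul_le_mul_of_nonneg_left (hga y) (abs_nonneg t)).trans ht
  calc _ ≤ |t * g y| ^ 3 := norm_cexp_mul_I_sub_le hsmall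
    _ = |t| ^ 3 * |g y| * g y ^ 2 := by rw [abs_mul, ← sq_abs (g y)]; ring
    _ ≤ |t| ^ 3 * a * g y ^ 2 := by gcongr; exact hga y

variable {Ω : Type*} [MeasurableSpace Ω] {P : Measure Ω} {X : ℕ → Ω → E}

lemma charFun_map_sum_comp [IsProbabilityMeasure P] (hX : iIndepFun X P)
    (hlaw : ∀ i, HasLaw (X i) μ P) {g : E → ℝ} (hg : Measurable g) (n : ℕ) (t : ℝ) :
    charFun (P.map fun ω => ∑ i ∈ Finset.range n, g (X i ω)) t = charFun (μ.map g) t ^ n := by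
  have hmeas : ∀ i, AEMeasurable (fun ω => g (X i ω)) P := fun i =>
    hg.comp_aemeasurable (hlaw i).aemeasurable
  have hindep : iIndepFun (fun i ω => g (X i ω)) P := hX.comp _ fun _ => hg
  have hmap : ∀ i, P.map (fun ω => g (X i ω)) = μ.map g := fun i => by
    rw [← (hlaw i).map_eq, AEMeasurable.map_map_of_aemeasurable hg.aemeasurable
      (hlaw i).aemeasurable]
    rfl
  rw [iIndepFun.charFun_map_fun_finsetSum_eq_prod (fun i _ => hmeas i) (hindep.restrict _)]
  simp [hmap]

lemma tendsto_charFun_map_pow [IsProbabilityMeasure μ] {g : ℕ → E → ℝ}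
    (hg : ∀ n, Measurable (g n)) (hmean : ∀ n, ∫ y, g n y ∂μ = 0) {a : ℕ → ℝ}
    (ha : Tendsto a atTop (𝓝 0)) (hga : ∀ᶠ n in atTop, ∀ y, |g n y| ≤ a n) {v : ℝ}
    (hvar : Tendsto (fun n : ℕ => n * Var[g n; μ]) atTop (𝓝 v)) (t : ℝ) :
    Tendsto (fun n => charFun (μ.map (g n)) t ^ n) atTop
      (𝓝 (Complex.exp (-(t ^ 2 / 2 * v) : ℝ))) := by
  have herr : Tendsto (fun n : ℕ => (n : ℂ) * (charFun (μ.map (g n)) t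
      - (1 - (t ^ 2 / 2 * Var[g n; μ] : ℝ)))) atTop (𝓝 0) := by
    have hbound : Tendsto (fun n : ℕ => |t| ^ 3 * a n * (n * Var[g n; μ])) atTop (𝓝 0) := by
      simpa using (ha.const_mul (|t| ^ 3)).mul hvar
    have hsmall : ∀ᶠ n in atTop, |t| * a n ≤ 1 :=
      (by simpa using ha.const_mul |t| : Tendsto _ _ (𝓝 (0 : ℝ))).eventually_le_const one_pos
    refine squeeze_zero_norm' ?_ hbound
    filter_upwards [hga, hsmall] with n hn htn
    rw [norm_mul, Complex.norm_natCast]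
    calc (n : ℝ) * _ ≤ n * (|t| ^ 3 * a n * Var[g n; μ]) := by
          gcongr; exact norm_charFun_map_sub_le (hg n) hn (hmean n) htn
      _ = _ := by ring
  have hquad : Tendsto (fun n : ℕ => ((-(t ^ 2 / 2 * (n * Var[g n; μ])) : ℝ) : ℂ)) atTop
      (𝓝 ((-(t ^ 2 / 2 * v) : ℝ) : ℂ)) :=
    (Complex.continuous_ofReal.tendsto _).comp (hvar.const_mul _).neg
  have hlim : Tendsto (fun n : ℕ => (n : ℂ) * (charFun (μ.map (g n)) t - 1)) atTop
      (𝓝 ((-(t ^ 2 / 2 * v) : ℝ) : ℂ)) := by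
    rw [← add_zero ((-(t ^ 2 / 2 * v) : ℝ) : ℂ)]
    refine (hquad.add herr).congr fun n => ?_
    push_cast
    ring
  exact (Complex.tendsto_one_add_pow_exp_of_tendsto hlim).congr fun n => by ring

theorem tendstoInDistribution_sum_of_bounded [IsProbabilityMeasure μ] [IsProbabilityMeasure P]
    (hX : iIndepFun X P) (hlaw : ∀ i, HasLaw (X i) μ P) {g : ℕ → E → ℝ} (hg : ∀ n, Measurable (g n))
    (hmean : ∀ n, ∫ y, g n y ∂μ = 0) {a : ℕ → ℝ}
    (ha : Tendsto a atTop (𝓝 0)) (hga : ∀ᶠ n in atTop, ∀ y, |g n y| ≤ a n) {v : ℝ}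
    (hvar : Tendsto (fun n : ℕ => n * Var[g n; μ]) atTop (𝓝 v)) :
    TendstoInDistribution (fun (n : ℕ) ω => ∑ i ∈ Finset.range n, g n (X i ω)) atTop id
      (fun _ => P) (gaussianReal 0 v.toNNReal) where
  forall_aemeasurable n := Finset.aemeasurable_fun_sum _ fun i _ =>
    (hg n).comp_aemeasurable (hlaw i).aemeasurable
  tendsto := by
    have hv : 0 ≤ v := ge_of_tendsto' hvar fun n => mul_nonneg n.cast_nonneg (variance_nonneg _ _)
    refine ProbabilityMeasure.tendsto_iff_tendsto_charFun.2 fun t => ?_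
    have hlimit : charFun ((gaussianReal 0 v.toNNReal).map id) t
        = Complex.exp (-(t ^ 2 / 2 * v) : ℝ) := by
      rw [Measure.map_id, charFun_gaussianReal, Real.coe_toNNReal v hv]
      push_cast
      ring_nf
    simp only [ProbabilityMeasure.coe_mk, charFun_map_sum_comp hX hlaw (hg _), hlimit]
    exact tendsto_charFun_map_pow hg hmean ha hga hvar t

theorem tendstoInDistribution_sum_sub_integral_of_bounded [IsProbabilityMeasure μ]
    [IsProbabilityMeasure P] (hX : iIndepFun X P) (hlaw : ∀ i, HasLaw (X i) μ P) {g : ℕ → E → ℝ}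
    (hg : ∀ n, Measurable (g n)) {a : ℕ → ℝ} (ha : Tendsto a atTop (𝓝 0))
    (hga : ∀ᶠ n in atTop, ∀ y, |g n y| ≤ a n) {v : ℝ}
    (hvar : Tendsto (fun n : ℕ => n * Var[g n; μ]) atTop (𝓝 v)) :
    TendstoInDistribution (fun (n : ℕ) ω => ∑ i ∈ Finset.range n, (g n (X i ω) - ∫ y, g n y ∂μ))
      atTop id (fun _ => P) (gaussianReal 0 v.toNNReal) := by
  have hcentred : ∀ n, ∫ y, (g n y - ∫ z, g n z ∂μ) ∂μ = 0 := fun n => by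
    simpa only [average_eq_integral] using integral_sub_average μ (g n)
  have hbound : ∀ᶠ n in atTop, ∀ y, |g n y - ∫ z, g n z ∂μ| ≤ 2 * a n := by
    filter_upwards [hga] with n hn y
    have hmean : |∫ z, g n z ∂μ| ≤ a n := by
      simpa using norm_integral_le_of_norm_le_const (μ := μ) (f := g n) (ae_of_all _ hn)
    linarith [abs_sub (g n y) (∫ z, g n z ∂μ), hn y]
  refine tendstoInDistribution_sum_of_bounded hX hlaw (fun n => (hg n).sub_const _) hcentred
    (by simpa using ha.const_mul 2) hbound ?_
  simpa only [variance_sub_const (hg _).aestronglyMeasurable] using hvar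

end CharFun

/-! ### Tangent planes of sets -/

section TangentPlanes

variable {E : Type*} [NormedAddCommGroup E] [InnerProductSpace ℝ E] [FiniteDimensional ℝ E]

/-- Every chord of `N` makes with the subspace `T` an angle whose sine is at most `ε`. -/
def IsNearlyFlat (T : Submodule ℝ E) (ε : ℝ) (N : Set E) : Prop :=
  ∀ a ∈ N, ∀ b ∈ N, ‖(a - b) - T.orthogonalProjectionOnto (a - b)‖ ≤ ε * ‖a - b‖

/-- `T` is the tangent plane of `S` at `x`: near `x` the set `S` is nearly flat in the direction
of `T`, and its projection to `T` has no holes. -/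
def IsTangentAt (S : Set E) (T : Submodule ℝ E) (x : E) : Prop :=
  ∀ ε > 0, ∃ r > 0, IsNearlyFlat T ε (S ∩ Metric.ball x r) ∧
    (fun a => T.orthogonalProjectionOnto (a - x)) '' (S ∩ Metric.ball x r) ∈ 𝓝 0

lemma IsNearlyFlat.mono {T : Submodule ℝ E} {ε : ℝ} {M N : Set E} (hN : IsNearlyFlat T ε N)
    (hMN : M ⊆ N) : IsNearlyFlat T ε M :=
  fun a ha b hb => hN a (hMN ha) b (hMN hb)

lemma IsNearlyFlat.norm_sub_le {T : Submodule ℝ E} {ε : ℝ} {N : Set E} (hN : IsNearlyFlat T ε N)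
    (hε : ε < 1) {a b : E} (ha : a ∈ N) (hb : b ∈ N) :
    ‖a - b‖ ≤ (1 - ε)⁻¹ * ‖T.orthogonalProjectionOnto (a - b)‖ := by
  have htriangle : ‖a - b‖ ≤ ‖(a - b) - T.orthogonalProjectionOnto (a - b)‖
      + ‖T.orthogonalProjectionOnto (a - b)‖ := by
    simpa using norm_add_le ((a - b) - T.orthogonalProjectionOnto (a - b))
      (T.orthogonalProjectionOnto (a - b) : E)
  rw [inv_mul_eq_div, le_div_iff₀ (by linarith)]
  linarith [hN a ha b hb]

section Preimage

variable {F : Type*} [NormedAddCommGroup F] [NormedSpace ℝ F] {f : E → F} {f' : E →L[ℝ] F} {x : E}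

lemma exists_norm_sub_orthogonalProjectionOnto_ker_le (f' : E →L[ℝ] F) :
    ∃ C > 0, ∀ u, ‖u - f'.ker.orthogonalProjectionOnto u‖ ≤ C * ‖f' u‖ := by
  have hinj : (f'.toLinearMap.domRestrict f'.kerᗮ).ker = ⊥ := by
    rw [LinearMap.ker_domRestrict]
    exact Submodule.disjoint_iff_comap_eq_bot.1 f'.ker.orthogonal_disjoint.symm
  obtain ⟨C, hC, hanti⟩ := LinearMap.exists_antilipschitzWith _ hinj
  refine ⟨C, hC, fun u => ?_⟩
  have hu : u - f'.ker.orthogonalProjectionOnto u ∈ f'.kerᗮ :=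
    f'.ker.sub_starProjection_mem_orthogonal u
  have hker : f' (f'.ker.orthogonalProjectionOnto u) = 0 :=
    (f'.ker.orthogonalProjectionOnto u).2
  have hf' : f' (u - f'.ker.orthogonalProjectionOnto u) = f' u := by rw [map_sub, hker, sub_zero]
  rw [← hf']
  exact ZeroHomClass.bound_of_antilipschitz _ hanti ⟨_, hu⟩

lemma exists_isNearlyFlat_preimage (hf : HasStrictFDerivAt f f' x) {ε : ℝ} (hε : 0 < ε) :
    ∃ r > 0, IsNearlyFlat f'.ker ε (f ⁻¹' {f x} ∩ Metric.ball x r) := by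
  obtain ⟨C, hC, hbound⟩ := exists_norm_sub_orthogonalProjectionOnto_ker_le f'
  have hsmall := hf.isLittleO.def (div_pos hε hC)
  rw [nhds_prod_eq, (Metric.nhds_basis_ball.prod_self).eventually_iff] at hsmall
  obtain ⟨r, hr, hsmall⟩ := hsmall
  refine ⟨r, hr, fun a ⟨ha, har⟩ b ⟨hb, hbr⟩ => ?_⟩
  have hab : ‖f' (a - b)‖ ≤ ε / C * ‖a - b‖ := by
    have hfab : f a - f b = 0 :=
      sub_eq_zero.2 ((Set.mem_singleton_iff.1 ha).trans (Set.mem_singleton_iff.1 hb).symm)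
    simpa only [hfab, zero_sub, norm_neg] using hsmall (x := (a, b)) ⟨har, hbr⟩
  calc _ ≤ C * ‖f' (a - b)‖ := hbound _
    _ ≤ C * (ε / C * ‖a - b‖) := by gcongr
    _ = ε * ‖a - b‖ := by field_simp

lemma image_orthogonalProjectionOnto_preimage_mem_nhds [CompleteSpace F]
    (hf : HasStrictFDerivAt f f' x) (hsurj : Function.Surjective f') {U : Set E} (hU : U ∈ 𝓝 x) :
    (fun a => f'.ker.orthogonalProjectionOnto (a - x)) '' (f ⁻¹' {f x} ∩ U) ∈ 𝓝 0 := by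
  set p := f'.ker.orthogonalProjectionOnto
  have hderiv : HasStrictFDerivAt (fun a => (p (a - x), f a)) (p.prod f') x := by
    refine HasStrictFDerivAt.prodMk ?_ hf
    simpa using p.hasStrictFDerivAt.comp x ((hasStrictFDerivAt_id x).sub_const x)
  have hrange : (p.prod f').range = ⊤ := by
    refine LinearMap.range_eq_top.2 fun ⟨z, s⟩ => ?_
    obtain ⟨v, rfl⟩ := hsurj s
    have hpz : p z = z := Submodule.orthogonalProjectionOnto_mem_subspace_eq_self z
    have hpv : p (p v) = p v := Submodule.orthogonalProjectionOnto_mem_subspace_eq_self _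
    have hz : f' z = 0 := z.2
    have hv : f' (p v) = 0 := (p v).2
    exact ⟨z + (v - p v), by simp [hpz, hpv, hz, hv]⟩
  have himage : (fun a => (p (a - x), f a)) '' U ∈ 𝓝 ((0 : f'.ker), f x) := by
    have hmem := image_mem_map (m := fun a => (p (a - x), f a)) hU
    rwa [hderiv.map_nhds_eq_of_surj hrange, sub_self, map_zero] at hmem
  have hslice : ∀ᶠ z in 𝓝 (0 : f'.ker), (z, f x) ∈ (fun a => (p (a - x), f a)) '' U :=
    (Continuous.prodMk_left (f x)).continuousAt.eventually himage
  filter_upwards [hslice] with z ⟨a, haU, ha⟩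
  simp only [Prod.mk.injEq] at ha
  exact ⟨a, ⟨ha.2, haU⟩, ha.1⟩

theorem isTangentAt_preimage [CompleteSpace F] (hf : HasStrictFDerivAt f f' x)
    (hsurj : Function.Surjective f') : IsTangentAt (f ⁻¹' {f x}) f'.ker x := fun _ hε =>
  let ⟨r, hr, hflat⟩ := exists_isNearlyFlat_preimage hf hε
  ⟨r, hr, hflat, image_orthogonalProjectionOnto_preimage_mem_nhds hf hsurj
    (Metric.ball_mem_nhds x hr)⟩

end Preimage

end TangentPlanes

/-! ### Hausdorff measure of nearly flat sets -/

section HausdorffMeasure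

variable {X Y : Type*} [EMetricSpace X] [MeasurableSpace X] [BorelSpace X] [EMetricSpace Y]
  [MeasurableSpace Y] [BorelSpace Y] {C : NNReal} {g : X → Y} {s : Set X}

lemma euclideanHausdorffMeasure_image_le (hg : LipschitzOnWith C g s) (m : ℕ) :
    μHE[m] (g '' s) ≤ (C : ENNReal) ^ m * μHE[m] s := by
  simp only [Measure.euclideanHausdorffMeasure_def, Measure.smul_apply, ENNReal.smul_def,
    smul_eq_mul, ← ENNReal.rpow_natCast]
  rw [mul_left_comm]
  gcongr
  exact hg.hausdorffMeasure_image_le m.cast_nonneg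

lemma le_euclideanHausdorffMeasure_image (hg : AntilipschitzWith C g) (m : ℕ) (s : Set X) :
    μHE[m] s ≤ (C : ENNReal) ^ m * μHE[m] (g '' s) := by
  simp only [Measure.euclideanHausdorffMeasure_def, Measure.smul_apply, ENNReal.smul_def,
    smul_eq_mul, ← ENNReal.rpow_natCast]
  rw [mul_left_comm]
  gcongr
  exact hg.le_hausdorffMeasure_image m.cast_nonneg s

end HausdorffMeasure

section Projection

variable {E : Type*} [NormedAddCommGroup E] [InnerProductSpace ℝ E] [FiniteDimensional ℝ E]
  [MeasurableSpace E] [BorelSpace E] {T : Submodule ℝ E} {N : Set E} {ε : ℝ}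

lemma volume_image_orthogonalProjectionOnto_le (A : Set E) (x : E) :
    volume ((fun a => T.orthogonalProjectionOnto (a - x)) '' A) ≤ μHE[finrank ℝ T] A := by
  have hlip : LipschitzOnWith 1 (fun a => T.orthogonalProjectionOnto (a - x)) A := by
    refine LipschitzOnWith.of_dist_le_mul fun a _ b _ => ?_
    rw [dist_eq_norm, ← map_sub, NNReal.coe_one, one_mul, dist_eq_norm, sub_sub_sub_cancel_right]
    exact T.norm_orthogonalProjectionOnto_apply_le _
  simpa [InnerProductSpace.euclideanHausdorffMeasure_eq_volume] using
    euclideanHausdorffMeasure_image_le hlip (finrank ℝ T)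

lemma IsNearlyFlat.euclideanHausdorffMeasure_le (hN : IsNearlyFlat T ε N) (hε : ε < 1) (x : E) :
    μHE[finrank ℝ T] N ≤ ENNReal.ofReal ((1 - ε)⁻¹ ^ finrank ℝ T) *
      volume ((fun a => T.orthogonalProjectionOnto (a - x)) '' N) := by
  have hpos : 0 ≤ (1 - ε)⁻¹ := inv_nonneg.2 (by linarith)
  have hanti : AntilipschitzWith (1 - ε)⁻¹.toNNReal
      (fun a : N => T.orthogonalProjectionOnto ((a : E) - x)) := by
    refine AntilipschitzWith.of_le_mul_dist fun a b => ?_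
    rw [Real.coe_toNNReal _ hpos, dist_eq_norm (T.orthogonalProjectionOnto _), ← map_sub,
      sub_sub_sub_cancel_right, Subtype.dist_eq, dist_eq_norm]
    exact hN.norm_sub_le hε a.2 b.2
  have himage := le_euclideanHausdorffMeasure_image hanti (finrank ℝ T) Set.univ
  rwa [← (isometry_subtype_coe (s := N)).euclideanHausdorffMeasure_image, Set.image_univ,
    Subtype.range_coe, Set.image_univ, InnerProductSpace.euclideanHausdorffMeasure_eq_volume,
    ← ENNReal.ofReal, ← ENNReal.ofReal_pow hpos,
    ← Set.image_eq_range fun a => T.orthogonalProjectionOnto (a - x)] at himage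

lemma IsNearlyFlat.map_orthogonalProjectionOnto_le (hN : IsNearlyFlat T ε N) (hε : ε < 1) (x : E) :
    ((μHE[finrank ℝ T] : Measure E).restrict N).map (fun a => T.orthogonalProjectionOnto (a - x))
      ≤ ENNReal.ofReal ((1 - ε)⁻¹ ^ finrank ℝ T) • volume := by
  have hmeas : Measurable (fun a => T.orthogonalProjectionOnto (a - x)) := by fun_prop
  refine Measure.le_iff.2 fun A hA => ?_
  rw [Measure.map_apply hmeas hA, Measure.restrict_apply (hmeas hA), Measure.smul_apply,
    smul_eq_mul]
  refine ((hN.mono Set.inter_subset_right).euclideanHausdorffMeasure_le hε x).trans ?_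
  gcongr
  rintro _ ⟨a, ha, rfl⟩
  exact ha.1

lemma restrict_le_map_orthogonalProjectionOnto {B : Set T} {x : E}
    (hB : B ⊆ (fun a => T.orthogonalProjectionOnto (a - x)) '' N) :
    volume.restrict B ≤ ((μHE[finrank ℝ T] : Measure E).restrict N).map
      (fun a => T.orthogonalProjectionOnto (a - x)) := by
  have hmeas : Measurable (fun a => T.orthogonalProjectionOnto (a - x)) := by fun_prop
  refine Measure.le_iff.2 fun A hA => ?_
  rw [Measure.map_apply hmeas hA, Measure.restrict_apply (hmeas hA), Measure.restrict_apply hA]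
  refine le_trans (measure_mono ?_) (volume_image_orthogonalProjectionOnto_le _ x)
  rintro z ⟨hzA, hzB⟩
  obtain ⟨a, ha, rfl⟩ := hB hzB
  exact ⟨a, ⟨hzA, ha⟩, rfl⟩

end Projection

/-! ### Upper regular measures -/

/-- Upper Ahlfors regularity of dimension `m` at all scales: balls of radius `r` have measure at
most `A * r ^ m`. The centre of the ball is not required to lie in the support. -/
def UpperRegularWith {X : Type*} [PseudoMetricSpace X] [MeasurableSpace X] (A : NNReal) (m : ℕ)
    (σ : Measure X) : Prop :=
  ∀ x, ∀ r > 0, σ (Metric.ball x r) ≤ A * ENNReal.ofReal (r ^ m)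

namespace UpperRegularWith

section PseudoMetric

variable {X : Type*} [PseudoMetricSpace X] [MeasurableSpace X] {A B : NNReal} {m : ℕ}
  {σ τ : Measure X}

lemma mono (hσ : UpperRegularWith A m σ) (hτσ : τ ≤ σ) : UpperRegularWith A m τ :=
  fun x r hr => (hτσ _).trans (hσ x r hr)

lemma add (hσ : UpperRegularWith A m σ) (hτ : UpperRegularWith B m τ) :
    UpperRegularWith (A + B) m (σ + τ) := fun x r hr => by
  simpa [add_mul] using add_le_add (hσ x r hr) (hτ x r hr)

lemma measure_ball_lt_top (hσ : UpperRegularWith A m σ) (x : X) (r : ℝ) :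
    σ (Metric.ball x r) < ⊤ := by
  rcases le_or_gt r 0 with hr | hr
  · simp [Metric.ball_eq_empty.2 hr]
  · exact (hσ x r hr).trans_lt (by finiteness)

lemma measure_lt_top_of_isBounded (hσ : UpperRegularWith A m σ) {S : Set X}
    (hS : Bornology.IsBounded S) : σ S < ⊤ := by
  rcases S.eq_empty_or_nonempty with rfl | ⟨x, -⟩
  · simp
  · obtain ⟨r, hr⟩ := hS.subset_ball x
    exact (measure_mono hr).trans_lt (hσ.measure_ball_lt_top x r)

lemma measureReal_ball_le (hσ : UpperRegularWith A m σ) (x : X) {r : ℝ} (hr : 0 < r) :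
    σ.real (Metric.ball x r) ≤ A * r ^ m := by
  refine ENNReal.toReal_le_of_le_ofReal (by positivity) ((hσ x r hr).trans_eq ?_)
  rw [ENNReal.ofReal_mul A.coe_nonneg, ENNReal.ofReal_coe_nnreal]

lemma abs_integral_le [OpensMeasurableSpace X] (hσ : UpperRegularWith A m σ) {g : X → ℝ} {b r : ℝ}
    {x : X} (hb : 0 ≤ b) (hr : 0 < r) (hgb : ∀ᵐ a ∂σ, |g a| ≤ b)
    (hg : ∀ᵐ a ∂σ, a ∉ Metric.ball x r → g a = 0) : |∫ a, g a ∂σ| ≤ b * (A * r ^ m) := by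
  rw [← setIntegral_eq_integral_of_ae_compl_eq_zero hg, ← Real.norm_eq_abs]
  refine (norm_setIntegral_le_of_norm_le_const_ae' (hσ.measure_ball_lt_top x r)
    (hgb.mono fun a ha _ => ha)).trans ?_
  gcongr
  exact hσ.measureReal_ball_le x hr

end PseudoMetric

end UpperRegularWith

section Regularity

variable {E : Type*} [NormedAddCommGroup E] [InnerProductSpace ℝ E] [FiniteDimensional ℝ E]
  [MeasurableSpace E] [BorelSpace E]

lemma IsNearlyFlat.exists_upperRegularWith {T : Submodule ℝ E} {ε : ℝ} {N : Set E}
    (hN : IsNearlyFlat T ε N) (hε : ε < 1) :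
    ∃ A, UpperRegularWith A (finrank ℝ T) ((μHE[finrank ℝ T] : Measure E).restrict N) := by
  refine ⟨((1 - ε)⁻¹ ^ finrank ℝ T).toNNReal * (volume (Metric.ball (0 : T) 1)).toNNReal,
    fun x r hr => ?_⟩
  have himage : (fun a => T.orthogonalProjectionOnto (a - x)) '' (Metric.ball x r ∩ N)
      ⊆ Metric.ball 0 r := by
    rintro _ ⟨a, ⟨ha, -⟩, rfl⟩
    rw [mem_ball_zero_iff]
    exact (T.norm_orthogonalProjectionOnto_apply_le _).trans_lt (mem_ball_iff_norm.1 ha)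
  rw [Measure.restrict_apply measurableSet_ball]
  calc _ ≤ _ := (hN.mono Set.inter_subset_right).euclideanHausdorffMeasure_le hε x
    _ ≤ _ := mul_le_mul_right (measure_mono himage) _
    _ = _ := by
      rw [Measure.addHaar_ball_of_pos volume _ hr, ENNReal.coe_mul,
        ENNReal.coe_toNNReal measure_ball_lt_top.ne, mul_assoc, ENNReal.ofReal,
        mul_comm (ENNReal.ofReal (r ^ _))]

theorem exists_upperRegularWith_of_isTangentAt {m : ℕ} {S : Set E} (hS : IsCompact S)
    (htan : ∀ x ∈ S, ∃ T : Submodule ℝ E, finrank ℝ T = m ∧ IsTangentAt S T x) :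
    ∃ A, UpperRegularWith A m ((μHE[m] : Measure E).restrict S) := by
  suffices H : ∃ A, UpperRegularWith A m ((μHE[m] : Measure E).restrict (S ∩ S)) by
    rwa [Set.inter_self] at H
  refine hS.induction_on
    (p := fun U => ∃ A, UpperRegularWith A m ((μHE[m] : Measure E).restrict (S ∩ U)))
    ⟨0, fun x r _ => by simp⟩ ?_ ?_ ?_
  · rintro U V hUV ⟨A, hV⟩
    exact ⟨A, hV.mono (Measure.restrict_mono (Set.inter_subset_inter_right _ hUV) le_rfl)⟩
  · rintro U V ⟨A, hU⟩ ⟨B, hV⟩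
    refine ⟨A + B, (hU.add hV).mono ?_⟩
    rw [Set.inter_union_distrib_left]
    exact Measure.restrict_union_le _ _
  · intro x hx
    obtain ⟨T, rfl, hTx⟩ := htan x hx
    obtain ⟨r, hr, hflat, -⟩ := hTx (1 / 2) one_half_pos
    exact ⟨Metric.ball x r, mem_nhdsWithin_of_mem_nhds (Metric.ball_mem_nhds x hr),
      hflat.exists_upperRegularWith one_half_lt_one⟩

end Regularity

/-! ### Blow-ups of measures -/

lemma abs_integral_sub_le_of_measure_le {X : Type*} [MeasurableSpace X] {μ τ : Measure X}
    {B : Set X} {c : ℝ} (hc : 0 ≤ c) (hl : μ.restrict B ≤ τ) (hu : τ ≤ ENNReal.ofReal c • μ)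
    {ψ : X → ℝ} (hψ : Integrable ψ μ) (hB : ∀ z ∉ B, ψ z = 0) :
    |∫ z, ψ z ∂τ - ∫ z, ψ z ∂μ| ≤ (c - 1) * ∫ z, |ψ z| ∂μ := by
  have hintegrable : ∀ {u : X → ℝ}, Integrable u μ → Integrable u τ := fun hu' =>
    (hu'.smul_measure ENNReal.ofReal_ne_top).mono_measure hu
  have hlower : ∀ {u : X → ℝ}, Integrable u μ → (∀ z, 0 ≤ u z) → (∀ z ∉ B, u z = 0) →
      ∫ z, u z ∂μ ≤ ∫ z, u z ∂τ := by
    intro u hui hu0 huB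
    rw [← setIntegral_eq_integral_of_forall_compl_eq_zero huB]
    exact integral_mono_measure hl (ae_of_all _ hu0) (hintegrable hui)
  have hupper : ∫ z, |ψ z| ∂τ ≤ c * ∫ z, |ψ z| ∂μ := by
    refine (integral_mono_measure hu (ae_of_all _ fun z => abs_nonneg _)
      (hψ.abs.smul_measure ENNReal.ofReal_ne_top)).trans_eq ?_
    rw [integral_smul_measure, ENNReal.toReal_ofReal hc, smul_eq_mul]
  have hplus := hlower (hψ.abs.add hψ) (fun z => neg_le_iff_add_nonneg'.1 (neg_abs_le (ψ z)))
    (fun z hz => by simp [hB z hz])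
  have hminus := hlower (hψ.abs.sub hψ) (fun z => sub_nonneg.2 (le_abs_self (ψ z)))
    (fun z hz => by simp [hB z hz])
  rw [integral_add' hψ.abs hψ, integral_add' (hintegrable hψ.abs) (hintegrable hψ)] at hplus
  rw [integral_sub' hψ.abs hψ, integral_sub' (hintegrable hψ.abs) (hintegrable hψ)] at hminus
  rw [abs_le]
  constructor <;> linarith

lemma comp_inv_smul_eq_zero {E : Type*} [SeminormedAddCommGroup E] [NormedSpace ℝ E] {φ : E → ℝ}
    {R h : ℝ} (hφ : ∀ z, R ≤ ‖z‖ → φ z = 0) (hh : 0 < h) {v : E} (hv : h * R ≤ ‖v‖) :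
    φ (h⁻¹ • v) = 0 := by
  refine hφ _ ?_
  rwa [norm_smul, norm_inv, Real.norm_of_nonneg hh.le, inv_mul_eq_div, le_div_iff₀' hh]

lemma setIntegral_inter_ball_comp_inv_smul_sub {E : Type*} [NormedAddCommGroup E]
    [NormedSpace ℝ E] [MeasurableSpace E] {σ : Measure E}
    {S : Set E} {x : E} {φ : E → ℝ} {R h r : ℝ} (hS : MeasurableSet S)
    (hφR : ∀ z, R ≤ ‖z‖ → φ z = 0) (hh : 0 < h) (hhR : h * R ≤ r) :
    ∫ a in S ∩ Metric.ball x r, φ (h⁻¹ • (a - x)) ∂σ = ∫ a in S, φ (h⁻¹ • (a - x)) ∂σ := by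
  refine (setIntegral_eq_of_subset_of_forall_sdiff_eq_zero hS Set.inter_subset_left ?_).symm
  rintro a ⟨haS, haN⟩
  refine comp_inv_smul_eq_zero hφR hh (hhR.trans ?_)
  rw [← not_lt, ← mem_ball_iff_norm]
  exact fun hball => haN ⟨haS, hball⟩

section ApproxTangentPlanes

variable {E : Type*} [NormedAddCommGroup E] [InnerProductSpace ℝ E] [FiniteDimensional ℝ E]

section Projection

variable {T : Submodule ℝ E} {N : Set E} {x : E} {φ : E → ℝ} {R ε η h : ℝ}

lemma IsNearlyFlat.comp_inv_smul_sub_eq_zero (hN : IsNearlyFlat T ε N) (hx : x ∈ N)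
    (hε : ε ≤ 1 / 2) (hφR : ∀ z, R ≤ ‖z‖ → φ z = 0) (hR : 0 < R) (hh : 0 < h) {a : E} (ha : a ∈ N)
    (hax : h * (2 * R) ≤ ‖a - x‖) :
    φ (h⁻¹ • (a - x)) = 0 ∧ φ (h⁻¹ • (T.orthogonalProjectionOnto (a - x) : E)) = 0 := by
  have hhR : 0 < h * R := by positivity
  have hinv : (1 - ε)⁻¹ ≤ 2 := by
    rw [inv_le_comm₀ (by linarith) two_pos]
    linarith
  have hproj : ‖a - x‖ ≤ 2 * ‖(T.orthogonalProjectionOnto (a - x) : E)‖ :=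
    (hN.norm_sub_le (by linarith) ha hx).trans
      (mul_le_mul_of_nonneg_right hinv (norm_nonneg _))
  exact ⟨comp_inv_smul_eq_zero hφR hh (by linarith), comp_inv_smul_eq_zero hφR hh (by linarith)⟩

lemma IsNearlyFlat.abs_comp_sub_comp_orthogonalProjectionOnto_le (hN : IsNearlyFlat T ε N)
    (hx : x ∈ N) (hε0 : 0 ≤ ε) (hε : ε ≤ 1 / 2) (hφR : ∀ z, R ≤ ‖z‖ → φ z = 0) (hR : 0 < R)
    (hη0 : 0 ≤ η) (hη : ∀ u v, ‖u - v‖ ≤ ε * (2 * R) → |φ u - φ v| ≤ η) (hh : 0 < h) {a : E}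
    (ha : a ∈ N) :
    |φ (h⁻¹ • (a - x)) - φ (h⁻¹ • (T.orthogonalProjectionOnto (a - x) : E))| ≤ η := by
  rcases le_or_gt (h * (2 * R)) ‖a - x‖ with hfar | hnear
  · obtain ⟨hzero, hzero_proj⟩ := hN.comp_inv_smul_sub_eq_zero hx hε hφR hR hh ha hfar
    rwa [hzero, hzero_proj, sub_zero, abs_zero]
  · refine hη _ _ ?_
    rw [← smul_sub, norm_smul, norm_inv, Real.norm_of_nonneg hh.le, inv_mul_le_iff₀ hh]
    calc _ ≤ ε * ‖a - x‖ := hN a ha x hx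
      _ ≤ ε * (h * (2 * R)) := by gcongr
      _ = h * (ε * (2 * R)) := by ring

variable [MeasurableSpace E] [BorelSpace E]

/-- A measure `σ` of dimension `dim T` has `T` as approximate tangent plane at `x`, with
multiplicity one: the blow-ups of `σ` at `x` converge vaguely to Lebesgue measure on `T`. -/
def HasApproxTangentAt (σ : Measure E) (T : Submodule ℝ E) (x : E) : Prop :=
  ∀ φ : E → ℝ, Continuous φ → HasCompactSupport φ →
    Tendsto (fun h : ℝ => (h ^ finrank ℝ T)⁻¹ * ∫ a, φ (h⁻¹ • (a - x)) ∂σ) (𝓝[>] 0)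
      (𝓝 (∫ z : T, φ z))

lemma IsNearlyFlat.abs_integral_comp_sub_comp_orthogonalProjectionOnto_le
    (hN : IsNearlyFlat T ε N) (hx : x ∈ N) (hε0 : 0 ≤ ε) (hε : ε ≤ 1 / 2) (hφ : Continuous φ)
    (hφR : ∀ z, R ≤ ‖z‖ → φ z = 0) (hR : 0 < R) (hη0 : 0 ≤ η)
    (hη : ∀ u v, ‖u - v‖ ≤ ε * (2 * R) → |φ u - φ v| ≤ η) (hh : 0 < h) {σ : Measure E}
    [IsFiniteMeasure σ] {A : NNReal} {m : ℕ} (hσ : UpperRegularWith A m σ)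
    (hσN : ∀ᵐ a ∂σ, a ∈ N) :
    |∫ a, φ (h⁻¹ • (a - x)) ∂σ - ∫ a, φ (h⁻¹ • (T.orthogonalProjectionOnto (a - x) : E)) ∂σ|
      ≤ η * (A * (h * (2 * R)) ^ m) := by
  obtain ⟨M, hM⟩ := (HasCompactSupport.intro (isCompact_closedBall (0 : E) R) fun z hz =>
    hφR z (by simpa using le_of_lt (by simpa using hz))).exists_bound_of_continuous hφ
  have hbounded : ∀ {g : E → E}, Continuous g → Integrable (fun a => φ (g a)) σ := fun hg =>
    .of_bound (hφ.comp hg).aestronglyMeasurable M (ae_of_all _ fun a => hM _)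
  rw [← integral_sub (hbounded (by fun_prop)) (hbounded (by fun_prop))]
  refine hσ.abs_integral_le (x := x) hη0 (by positivity) ?_ ?_
  · filter_upwards [hσN] with a ha
    exact hN.abs_comp_sub_comp_orthogonalProjectionOnto_le hx hε0 hε hφR hR hη0 hη hh ha
  · filter_upwards [hσN] with a ha hfar
    rw [mem_ball_iff_norm, not_lt] at hfar
    obtain ⟨hzero, hzero_proj⟩ := hN.comp_inv_smul_sub_eq_zero hx hε hφR hR hh ha hfar
    rw [hzero, hzero_proj, sub_zero]

lemma IsNearlyFlat.abs_setIntegral_comp_orthogonalProjectionOnto_sub_le (hN : IsNearlyFlat T ε N)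
    (hε : ε < 1) {ρ : ℝ}
    (hcover : Metric.ball 0 ρ ⊆ (fun a => T.orthogonalProjectionOnto (a - x)) '' N)
    (hφ : Continuous φ) (hφR : ∀ z, R ≤ ‖z‖ → φ z = 0) (hh : 0 < h) (hhR : h * R ≤ ρ) :
    |∫ a in N, φ (h⁻¹ • (T.orthogonalProjectionOnto (a - x) : E)) ∂μHE[finrank ℝ T]
        - h ^ finrank ℝ T * ∫ z : T, φ z|
      ≤ ((1 - ε)⁻¹ ^ finrank ℝ T - 1) * (h ^ finrank ℝ T * ∫ z : T, |φ z|) := by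
  have hscale : ∀ ψ : E → ℝ,
      ∫ z : T, ψ (h⁻¹ • (z : E)) = h ^ finrank ℝ T * ∫ z : T, ψ z := fun ψ => by
    have := Measure.integral_comp_inv_smul volume (fun z : T => ψ z) h
    rwa [abs_of_pos (by positivity), smul_eq_mul] at this
  have hsupp : HasCompactSupport (fun z : T => φ (h⁻¹ • (z : E))) :=
    .intro (isCompact_closedBall 0 (h * R)) fun z hz => comp_inv_smul_eq_zero hφR hh
      (by simpa using le_of_lt (by simpa using hz))
  have hint : Integrable (fun z : T => φ (h⁻¹ • (z : E))) :=
    (show Continuous _ by fun_prop).integrable_of_hasCompactSupport hsupp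
  have hone : 0 ≤ (1 - ε)⁻¹ := inv_nonneg.2 (by linarith)
  have hcompare := abs_integral_sub_le_of_measure_le (pow_nonneg hone _)
    (restrict_le_map_orthogonalProjectionOnto hcover) (hN.map_orthogonalProjectionOnto_le hε x)
    hint fun z hz => comp_inv_smul_eq_zero hφR hh (hhR.trans (by simpa using hz))
  rwa [integral_map (by fun_prop) (by fun_prop), hscale φ, hscale fun z => |φ z|] at hcompare

end Projection

variable [MeasurableSpace E] [BorelSpace E]

lemma IsNearlyFlat.abs_inv_mul_setIntegral_sub_le {S : Set E} (hS : MeasurableSet S)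
    {T : Submodule ℝ E} {A : NNReal}
    (hreg : UpperRegularWith A (finrank ℝ T) ((μHE[finrank ℝ T] : Measure E).restrict S)) {x : E}
    (hx : x ∈ S) {ε r ρ : ℝ} (hr : 0 < r) (hflat : IsNearlyFlat T ε (S ∩ Metric.ball x r))
    (hcover : Metric.ball 0 ρ ⊆
      (fun a => T.orthogonalProjectionOnto (a - x)) '' (S ∩ Metric.ball x r))
    (hε0 : 0 ≤ ε) (hε : ε ≤ 1 / 2) {φ : E → ℝ} (hφ : Continuous φ) {R η h : ℝ}
    (hφR : ∀ z, R ≤ ‖z‖ → φ z = 0) (hR : 0 < R) (hη0 : 0 ≤ η)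
    (hη : ∀ u v, ‖u - v‖ ≤ ε * (2 * R) → |φ u - φ v| ≤ η) (hh : 0 < h) (hhr : h * R ≤ r)
    (hhρ : h * R ≤ ρ) :
    |(h ^ finrank ℝ T)⁻¹ * ∫ a in S, φ (h⁻¹ • (a - x)) ∂μHE[finrank ℝ T] - ∫ z : T, φ z|
      ≤ η * (A * (2 * R) ^ finrank ℝ T)
        + ((1 - ε)⁻¹ ^ finrank ℝ T - 1) * ∫ z : T, |φ z| := by
  set k := finrank ℝ T
  set N := S ∩ Metric.ball x r
  have hNS : (μHE[k] : Measure E).restrict N ≤ (μHE[k] : Measure E).restrict S :=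
    Measure.restrict_mono Set.inter_subset_left le_rfl
  have : IsFiniteMeasure ((μHE[k] : Measure E).restrict N) := by
    refine ⟨?_⟩
    rw [Measure.restrict_apply_univ, show N = Metric.ball x r ∩ S from Set.inter_comm _ _,
      ← Measure.restrict_apply measurableSet_ball]
    exact hreg.measure_ball_lt_top x r
  have hproject := hflat.abs_integral_comp_sub_comp_orthogonalProjectionOnto_le
    ⟨hx, Metric.mem_ball_self hr⟩ hε0 hε hφ hφR hR hη0 hη hh (hreg.mono hNS)
    (ae_restrict_mem (hS.inter measurableSet_ball))
  have hcompare := hflat.abs_setIntegral_comp_orthogonalProjectionOnto_sub_le (by linarith)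
    hcover hφ hφR hh hhρ
  rw [setIntegral_inter_ball_comp_inv_smul_sub hS hφR hh hhr] at hproject
  have hhk : 0 < h ^ k := by positivity
  have hsplit : (h ^ k)⁻¹ * ∫ a in S, φ (h⁻¹ • (a - x)) ∂μHE[k] - ∫ z : T, φ z
      = (h ^ k)⁻¹ * (∫ a in S, φ (h⁻¹ • (a - x)) ∂μHE[k] - h ^ k * ∫ z : T, φ z) := by
    field_simp
  rw [hsplit, abs_mul, abs_of_pos (inv_pos.2 hhk), inv_mul_le_iff₀ hhk]
  refine ((abs_sub_le _ _ _).trans (add_le_add hproject hcompare)).trans_eq ?_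
  ring

theorem hasApproxTangentAt_of_isTangentAt {S : Set E} (hS : MeasurableSet S)
    {T : Submodule ℝ E} {A : NNReal}
    (hreg : UpperRegularWith A (finrank ℝ T) ((μHE[finrank ℝ T] : Measure E).restrict S)) {x : E}
    (hx : x ∈ S) (htan : IsTangentAt S T x) :
    HasApproxTangentAt ((μHE[finrank ℝ T] : Measure E).restrict S) T x := by
  intro φ hφ hφc
  obtain ⟨R, hR, hφR⟩ := hφc.exists_pos_le_norm
  set V := A * (2 * R) ^ finrank ℝ T
  set I := ∫ z : T, |φ z|
  rw [Metric.tendsto_nhds]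
  intro κ hκ
  obtain ⟨η, hη0, hη⟩ := exists_pos_mul_lt (half_pos hκ) V
  obtain ⟨δ, hδ, hmodulus⟩ :=
    Metric.uniformContinuous_iff_le.1 (hφc.uniformContinuous_of_continuous hφ) η hη0
  have hdistortion : Tendsto (fun ε : ℝ => ((1 - ε)⁻¹ ^ finrank ℝ T - 1) * I) (𝓝[>] 0) (𝓝 0) := by
    have hcont : ContinuousAt (fun ε : ℝ => ((1 - ε)⁻¹ ^ finrank ℝ T - 1) * I) 0 :=
      ((((continuousAt_const.sub continuousAt_id).inv₀ (by simp)).pow _).sub_const 1).mul_const I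
    simpa using hcont.tendsto.mono_left nhdsWithin_le_nhds
  have hscale : ∀ c, Tendsto (fun s : ℝ => s * c) (𝓝[>] 0) (𝓝 0) := fun c => by
    simpa using (tendsto_id.mul_const c).mono_left (nhdsWithin_le_nhds (a := (0 : ℝ)))
  obtain ⟨ε, hεκ, hεδ, hε, hε0⟩ := ((hdistortion.eventually_lt_const (half_pos hκ)).and
    (((hscale (2 * R)).eventually_le_const hδ).and
      (((eventually_le_nhds one_half_pos).filter_mono nhdsWithin_le_nhds).and
        self_mem_nhdsWithin))).exists
  obtain ⟨r, hr, hflat, hcover⟩ := htan ε hε0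
  obtain ⟨ρ, hρ, hcover⟩ := Metric.mem_nhds_iff.1 hcover
  filter_upwards [self_mem_nhdsWithin, (hscale R).eventually_le_const hr,
    (hscale R).eventually_le_const hρ] with h hh hhr hhρ
  have hbound := hflat.abs_inv_mul_setIntegral_sub_le hS hreg hx hr hcover hε0.le hε hφ hφR hR
    hη0.le (fun u v huv => hmodulus ((dist_eq_norm u v).trans_le (huv.trans hεδ))) hh hhr hhρ
  rw [Real.dist_eq]
  linarith

end ApproxTangentPlanes

/-! ### Smoothed measures -/

section KernelTransform

variable {X Y : Type*} [TopologicalSpace X] [MeasurableSpace X] [BorelSpace X]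
  [TopologicalSpace Y] {σ : Measure X} [IsFiniteMeasure σ]
  {w : X → ℝ} {k : X → Y → ℝ} {C M : ℝ}

lemma continuous_integral_mul_of_bounded [FirstCountableTopology Y]
    (hw : AEStronglyMeasurable w σ) (hwC : ∀ᵐ x ∂σ, |w x| ≤ C)
    (hk : Continuous (Function.uncurry k)) (hkM : ∀ x y, |k x y| ≤ M) :
    Continuous fun y => ∫ x, w x * k x y ∂σ := by
  refine continuous_of_dominated (bound := fun _ => C * M) (fun y => ?_) (fun y => ?_)
    (integrable_const _) (ae_of_all _ fun x => ?_)
  · exact hw.mul (hk.comp (by fun_prop : Continuous fun x => (x, y))).aestronglyMeasurable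
  · filter_upwards [hwC] with x hx
    rw [norm_mul]
    exact mul_le_mul hx (hkM x y) (abs_nonneg _) ((abs_nonneg _).trans hx)
  · exact continuous_const.mul (hk.comp (by fun_prop : Continuous fun y => (x, y)))

lemma integral_integral_mul_swap [SecondCountableTopology X] [MeasurableSpace Y] [BorelSpace Y]
    [SecondCountableTopology Y] {μ : Measure Y} [IsFiniteMeasure μ] {g : Y → ℝ} {B : ℝ}
    (hw : AEStronglyMeasurable w σ) (hwC : ∀ᵐ x ∂σ, |w x| ≤ C)
    (hk : Continuous (Function.uncurry k)) (hkM : ∀ x y, |k x y| ≤ M)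
    (hg : AEStronglyMeasurable g μ) (hgB : ∀ y, |g y| ≤ B) :
    ∫ y, (∫ x, w x * k x y ∂σ) * g y ∂μ = ∫ x, w x * ∫ y, k x y * g y ∂μ ∂σ := by
  have hint : Integrable (Function.uncurry fun x y => w x * (k x y * g y)) (σ.prod μ) := by
    refine .of_bound (hw.comp_fst.mul (hk.aestronglyMeasurable.mul hg.comp_snd)) (C * (M * B)) ?_
    filter_upwards [Measure.quasiMeasurePreserving_fst.ae hwC] with z hz
    rw [Function.uncurry, norm_mul, norm_mul]
    have hM := (abs_nonneg _).trans (hkM z.1 z.2)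
    exact mul_le_mul hz (mul_le_mul (hkM _ _) (hgB _) (abs_nonneg _) hM) (by positivity)
      ((abs_nonneg _).trans hz)
  simp_rw [← integral_const_mul, ← integral_mul_const, mul_assoc]
  exact (integral_integral_swap hint).symm

end KernelTransform

lemma exists_thickening_forall_abs_le {X : Type*} [PseudoMetricSpace X] {S : Set X}
    (hS : IsCompact S) {f : X → ℝ} (hf : ∀ x ∈ S, ContinuousAt f x) :
    ∃ Λ, ∃ ρ > 0, ∀ x ∈ S, ∀ y ∈ Metric.ball x ρ, |f y| ≤ Λ := by
  obtain ⟨Λ, hΛ⟩ : ∃ Λ, ∀ᶠ y in 𝓝ˢ S, |f y| ≤ Λ := by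
    refine hS.induction_on (p := fun s => ∃ Λ, ∀ᶠ y in 𝓝ˢ s, |f y| ≤ Λ) ⟨0, by simp⟩
      (fun s t hst ⟨Λ, hΛ⟩ => ⟨Λ, hΛ.filter_mono (nhdsSet_mono hst)⟩) ?_ fun x hx => ?_
    · rintro s t ⟨Λ, hΛ⟩ ⟨Λ', hΛ'⟩
      refine ⟨max Λ Λ', ?_⟩
      rw [nhdsSet_union, eventually_sup]
      exact ⟨hΛ.mono fun y hy => hy.trans (le_max_left _ _),
        hΛ'.mono fun y hy => hy.trans (le_max_right _ _)⟩
    · have hlocal : ∀ᶠ y in 𝓝 x, |f y| ≤ |f x| + 1 :=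
        (hf x hx).abs.eventually_le_const (lt_add_one _)
      exact ⟨_, mem_nhdsWithin_of_mem_nhds hlocal.eventually_nhds, |f x| + 1,
        eventually_nhdsSet_iff_forall.2 fun y hy => hy⟩
  obtain ⟨ρ, hρ, hthick⟩ := hS.exists_thickening_subset_open isOpen_interior
    (subset_interior_iff_mem_nhdsSet.2 hΛ)
  refine ⟨Λ, ρ, hρ, fun x hx y hy => ?_⟩
  have hmem : y ∈ {y | |f y| ≤ Λ} :=
    interior_subset (hthick (Metric.mem_thickening_iff.2 ⟨x, hx, hy⟩))
  exact hmem

lemma aestronglyMeasurable_of_continuousOn {X : Type*} [TopologicalSpace X] [MeasurableSpace X]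
    [OpensMeasurableSpace X] [SecondCountableTopology X] {S : Set X} {σ : Measure X}
    (hS : MeasurableSet S) (hσS : ∀ᵐ x ∂σ, x ∈ S) {w : X → ℝ} (hw : ContinuousOn w S) :
    AEStronglyMeasurable w σ := by
  rw [← Measure.restrict_eq_self_of_ae_mem hσS]
  exact hw.aestronglyMeasurable hS

lemma sub_smul_mem_ball {E : Type*} [SeminormedAddCommGroup E] [NormedSpace ℝ E] {K : E → ℝ}
    {R ρ h : ℝ} (hKR : ∀ z, R ≤ ‖z‖ → K z = 0) (hh : 0 < h) (hhρ : h * R ≤ ρ) {x u : E}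
    (hu : K u ≠ 0) : x - h • u ∈ Metric.ball x ρ := by
  rw [mem_ball_iff_norm, sub_sub_cancel_left, norm_neg, norm_smul, Real.norm_of_nonneg hh.le]
  have huR : ‖u‖ < R := not_le.1 fun hRu => hu (hKR u hRu)
  exact (mul_lt_mul_of_pos_left huR hh).trans_le hhρ

section CompactSupport

variable {X : Type*} [TopologicalSpace X] [MeasurableSpace X] {S : Set X} {σ : Measure X}
  {w : X → ℝ}

lemma exists_pos_ae_abs_le (hS : IsCompact S) (hσS : ∀ᵐ x ∂σ, x ∈ S) (hw : ContinuousOn w S) :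
    ∃ C > 0, ∀ᵐ x ∂σ, |w x| ≤ C := by
  obtain ⟨C, hC, hwC⟩ := (hS.image_of_continuousOn hw).isBounded.exists_pos_norm_le
  exact ⟨C, hC, hσS.mono fun x hx => hwC _ (Set.mem_image_of_mem w hx)⟩

lemma integrable_of_continuousOn [BorelSpace X] [T2Space X] [SecondCountableTopology X]
    [IsFiniteMeasure σ] (hS : IsCompact S) (hσS : ∀ᵐ x ∂σ, x ∈ S) (hw : ContinuousOn w S) :
    Integrable w σ :=
  have ⟨C, _, hwC⟩ := exists_pos_ae_abs_le hS hσS hw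
  .of_bound (aestronglyMeasurable_of_continuousOn hS.measurableSet hσS hw) C hwC

end CompactSupport

section Smoothing

variable {E : Type*} [NormedAddCommGroup E] [NormedSpace ℝ E] [MeasurableSpace E]

/-- The smoothing at scale `h`, with kernel `K`, of the measure with density `w` with respect
to `σ`, without the normalizing power of `h`. -/
def smoothing (σ : Measure E) (w K : E → ℝ) (h : ℝ) (y : E) : ℝ :=
  ∫ x, w x * K (h⁻¹ • (x - y)) ∂σ

variable [OpensMeasurableSpace E] {σ : Measure E} {A : NNReal} {m : ℕ}

lemma UpperRegularWith.abs_smoothing_le {w K : E → ℝ} (hσ : UpperRegularWith A m σ) {C M R h : ℝ}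
    (hC : 0 ≤ C) (hwC : ∀ᵐ x ∂σ, |w x| ≤ C) (hKM : ∀ z, |K z| ≤ M)
    (hKR : ∀ z, R ≤ ‖z‖ → K z = 0) (hR : 0 < R) (hh : 0 < h) (y : E) :
    |(h ^ m)⁻¹ * smoothing σ w K h y| ≤ C * M * (A * R ^ m) := by
  have hM : 0 ≤ M := (abs_nonneg _).trans (hKM 0)
  have hbound : |smoothing σ w K h y| ≤ C * M * (A * (h * R) ^ m) := by
    refine hσ.abs_integral_le (x := y) (by positivity) (by positivity) ?_ ?_
    · filter_upwards [hwC] with x hx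
      rw [abs_mul]
      exact mul_le_mul hx (hKM _) (abs_nonneg _) hC
    · refine ae_of_all _ fun x hx => ?_
      rw [comp_inv_smul_eq_zero hKR hh (not_lt.1 (mt mem_ball_iff_norm.2 hx)), mul_zero]
  rw [abs_mul, abs_of_pos (by positivity : 0 < (h ^ m)⁻¹), inv_mul_le_iff₀ (by positivity)]
  exact hbound.trans_eq (by ring)

lemma exists_abs_smoothing_le {S : Set E} {w K : E → ℝ} (hS : IsCompact S) (hσS : ∀ᵐ x ∂σ, x ∈ S)
    (hσ : UpperRegularWith A m σ) (hw : ContinuousOn w S) (hK : Continuous K)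
    (hKc : HasCompactSupport K) :
    ∃ B, ∀ h > 0, ∀ y, |(h ^ m)⁻¹ * smoothing σ w K h y| ≤ B := by
  obtain ⟨C, hC, hwC⟩ := exists_pos_ae_abs_le hS hσS hw
  obtain ⟨M, hM⟩ := hKc.exists_bound_of_continuous hK
  obtain ⟨R, hR, hKR⟩ := hKc.exists_pos_le_norm
  exact ⟨_, fun h hh => hσ.abs_smoothing_le hC.le hwC hM hKR hR hh⟩

lemma UpperRegularWith.abs_integral_sub_mul_le (hσ : UpperRegularWith A m σ) {w φ : E → ℝ} {x : E}
    {η M R r h : ℝ} (hη : 0 ≤ η) (hwη : ∀ᵐ a ∂σ, dist a x < r → |w a - w x| ≤ η)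
    (hφM : ∀ z, |φ z| ≤ M) (hφR : ∀ z, R ≤ ‖z‖ → φ z = 0) (hR : 0 < R) (hh : 0 < h)
    (hhr : h * R ≤ r) :
    |∫ a, (w a - w x) * φ (h⁻¹ • (a - x)) ∂σ| ≤ η * M * (A * (h * R) ^ m) := by
  have hM : 0 ≤ M := (abs_nonneg _).trans (hφM 0)
  have hzero : ∀ a, h * R ≤ ‖a - x‖ → φ (h⁻¹ • (a - x)) = 0 := fun a =>
    comp_inv_smul_eq_zero hφR hh
  refine hσ.abs_integral_le (x := x) (by positivity) (mul_pos hh hR) ?_ (ae_of_all _ fun a ha => ?_)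
  · filter_upwards [hwη] with a ha
    rw [abs_mul]
    rcases lt_or_ge (dist a x) r with hnear | hfar
    · exact mul_le_mul (ha hnear) (hφM _) (abs_nonneg _) hη
    · rw [hzero a (hhr.trans (dist_eq_norm a x ▸ hfar)), abs_zero, mul_zero]
      positivity
  · rw [hzero a (not_lt.1 (mt mem_ball_iff_norm.2 ha)), mul_zero]

end Smoothing

section SmoothedLimits

variable {E : Type*} [NormedAddCommGroup E] [InnerProductSpace ℝ E] [MeasurableSpace E]

section BlowUp

variable [FiniteDimensional ℝ E] [BorelSpace E] {S : Set E} {σ : Measure E} [IsFiniteMeasure σ]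
  {w : E → ℝ} {T : Submodule ℝ E} {A : NNReal} {x : E}

lemma HasApproxTangentAt.tendsto_integral_mul (hT : HasApproxTangentAt σ T x)
    (hreg : UpperRegularWith A (finrank ℝ T) σ) (hσS : ∀ᵐ a ∂σ, a ∈ S)
    (hwi : Integrable w σ) (hw : ContinuousWithinAt w S x) {φ : E → ℝ} (hφ : Continuous φ)
    (hφc : HasCompactSupport φ) :
    Tendsto (fun h : ℝ => (h ^ finrank ℝ T)⁻¹ * ∫ a, w a * φ (h⁻¹ • (a - x)) ∂σ) (𝓝[>] 0)
      (𝓝 (w x * ∫ z : T, φ z)) := by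
  obtain ⟨R, hR, hφR⟩ := hφc.exists_pos_le_norm
  obtain ⟨M, hM⟩ := hφc.exists_bound_of_continuous hφ
  set k := finrank ℝ T
  have hdiff : Tendsto (fun h : ℝ => (h ^ k)⁻¹ * ∫ a, (w a - w x) * φ (h⁻¹ • (a - x)) ∂σ)
      (𝓝[>] 0) (𝓝 0) := by
    rw [Metric.tendsto_nhds]
    intro κ hκ
    obtain ⟨η, hη, hηκ⟩ := exists_pos_mul_lt hκ (M * (A * R ^ k))
    obtain ⟨r, hr, hwr⟩ := Metric.continuousWithinAt_iff.1 hw η hη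
    have hsmall : ∀ᶠ h : ℝ in 𝓝[>] 0, h * R < r :=
      ((tendsto_id.mul_const R).mono_left nhdsWithin_le_nhds).eventually_lt_const (by simpa)
    filter_upwards [hsmall, self_mem_nhdsWithin] with h hhr hh
    have hhk : 0 < h ^ k := pow_pos hh k
    have hbound := hreg.abs_integral_sub_mul_le hη.le (hσS.mono fun a ha hax => (hwr ha hax).le)
      hM hφR hR hh hhr.le
    rw [dist_zero_right, norm_mul, Real.norm_of_nonneg (inv_pos.2 hhk).le, inv_mul_lt_iff₀ hhk]
    calc _ ≤ η * M * (A * (h * R) ^ k) := hbound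
      _ = h ^ k * (M * (A * R ^ k) * η) := by ring
      _ < h ^ k * κ := by gcongr
  have hlim := hdiff.add ((hT φ hφ hφc).const_mul (w x))
  rw [zero_add] at hlim
  refine hlim.congr fun h => ?_
  have hφm : AEStronglyMeasurable (fun a => φ (h⁻¹ • (a - x))) σ :=
    Continuous.aestronglyMeasurable (by fun_prop)
  have hφi : Integrable (fun a => φ (h⁻¹ • (a - x))) σ :=
    .of_bound hφm M (ae_of_all _ fun a => hM _)
  simp_rw [sub_mul]
  rw [integral_sub (hwi.mul_bdd hφm (ae_of_all _ fun a => hM _)) (hφi.const_mul _),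
    integral_const_mul]
  ring

lemma HasApproxTangentAt.tendsto_smoothing (hT : HasApproxTangentAt σ T x)
    (hreg : UpperRegularWith A (finrank ℝ T) σ) (hσS : ∀ᵐ a ∂σ, a ∈ S)
    (hwi : Integrable w σ) (hw : ContinuousWithinAt w S x) {K : E → ℝ} (hK : Continuous K)
    (hKc : HasCompactSupport K) (u : E) :
    Tendsto (fun h : ℝ => (h ^ finrank ℝ T)⁻¹ * smoothing σ w K h (x - h • u)) (𝓝[>] 0)
      (𝓝 (w x * ∫ z : T, K (z + u))) := by
  refine (hT.tendsto_integral_mul hreg hσS hwi hw (φ := fun z => K (z + u)) (by fun_prop)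
    (hKc.comp_homeomorph (Homeomorph.addRight u))).congr' ?_
  filter_upwards [self_mem_nhdsWithin] with h hh
  simp_rw [smoothing, ← sub_add, smul_add, inv_smul_smul₀ (Set.mem_Ioi.1 hh).ne']

end BlowUp

lemma tendsto_integral_mul_of_bounded {X ι : Type*} [MeasurableSpace X] {μ : Measure X}
    {l : Filter ι} [l.IsCountablyGenerated] {k : X → ℝ} (hk : Integrable k μ) {Ψ : ι → X → ℝ}
    {Ψ₀ : X → ℝ} {B : ℝ} (hΨm : ∀ᶠ i in l, AEStronglyMeasurable (Ψ i) μ)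
    (hΨB : ∀ᶠ i in l, ∀ᵐ u ∂μ, k u ≠ 0 → |Ψ i u| ≤ B)
    (hΨ : ∀ᵐ u ∂μ, Tendsto (fun i => Ψ i u) l (𝓝 (Ψ₀ u))) :
    Tendsto (fun i => ∫ u, k u * Ψ i u ∂μ) l (𝓝 (∫ u, k u * Ψ₀ u ∂μ)) := by
  refine tendsto_integral_filter_of_dominated_convergence (fun u => |k u| * B)
    (hΨm.mono fun i hi => hk.aestronglyMeasurable.mul hi)
    (hΨB.mono fun i hi => hi.mono fun u hu => ?_) (hk.abs.mul_const B)
    (hΨ.mono fun u hu => hu.const_mul (k u))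
  rw [norm_mul]
  by_cases hku : k u = 0
  · simp [hku]
  · exact mul_le_mul_of_nonneg_left (hu hku) (norm_nonneg _)

lemma abs_integral_mul_le_of_bounded {X : Type*} [MeasurableSpace X] {μ : Measure X} {k : X → ℝ}
    (hk : Integrable k μ) {Ψ : X → ℝ} {B : ℝ} (hΨB : ∀ u, k u ≠ 0 → |Ψ u| ≤ B) :
    |∫ u, k u * Ψ u ∂μ| ≤ B * ∫ u, |k u| ∂μ := by
  rw [← integral_const_mul, ← Real.norm_eq_abs]
  refine norm_integral_le_of_norm_le (hk.abs.const_mul B) (ae_of_all _ fun u => ?_)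
  rw [norm_mul, mul_comm B]
  by_cases hu : k u = 0
  · simp [hu]
  · exact mul_le_mul_of_nonneg_left (hΨB u hu) (norm_nonneg _)

/-- The measure with density `f` with respect to Lebesgue measure. -/
abbrev densityMeasure {X : Type*} [MeasureSpace X] (f : X → ℝ) : Measure X :=
  volume.withDensity fun x => ENNReal.ofReal (f x)

lemma integral_densityMeasure {X : Type*} [MeasureSpace X] {f : X → ℝ} (hf : Measurable f)
    (hf0 : ∀ x, 0 ≤ f x) (g : X → ℝ) :
    ∫ y, g y ∂densityMeasure f = ∫ y, f y * g y := by
  rw [densityMeasure, integral_withDensity_eq_integral_toReal_smul (by fun_prop)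
    (ae_of_all _ fun _ => ENNReal.ofReal_lt_top)]
  simp_rw [ENNReal.toReal_ofReal (hf0 _), smul_eq_mul]

section Density

variable [FiniteDimensional ℝ E] [BorelSpace E] {f K : E → ℝ} {F : ℝ → E → ℝ} {Λ B R ρ h : ℝ}
  {x : E}

lemma integral_comp_inv_smul_sub_mul (hh : 0 < h) (k g : E → ℝ) (x : E) :
    ∫ y, k (h⁻¹ • (x - y)) * g y = h ^ finrank ℝ E * ∫ u, k u * g (x - h • u) := by
  have hscale := Measure.integral_comp_inv_smul volume (fun u => k u * g (x - h • u)) h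
  rw [abs_of_pos (by positivity), smul_eq_mul] at hscale
  rw [← hscale, ← integral_sub_left_eq_self (fun y => k (h⁻¹ • y) * g (x - h • h⁻¹ • y)) volume x]
  simp_rw [smul_inv_smul₀ hh.ne', sub_sub_cancel]

lemma inv_pow_mul_integral_comp_inv_smul_sub_mul (hf : Measurable f) (hf0 : ∀ x, 0 ≤ f x)
    (hh : 0 < h) (g : E → ℝ) (x : E) :
    (h ^ finrank ℝ E)⁻¹ * ∫ y, K (h⁻¹ • (x - y)) * g y ∂densityMeasure f
      = ∫ u, K u * (f (x - h • u) * g (x - h • u)) := by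
  rw [integral_densityMeasure hf hf0, inv_mul_eq_iff_eq_mul₀ (by positivity),
    ← integral_comp_inv_smul_sub_mul hh K (fun y => f y * g y)]
  simp_rw [mul_left_comm]

lemma abs_integral_comp_inv_smul_sub_mul_le (hf : Measurable f) (hf0 : ∀ x, 0 ≤ f x)
    (hK : Integrable K) (hKR : ∀ z, R ≤ ‖z‖ → K z = 0) (hfΛ : ∀ y ∈ Metric.ball x ρ, |f y| ≤ Λ)
    {g : E → ℝ} (hg : ∀ y, |g y| ≤ B) (hh : 0 < h) (hhρ : h * R ≤ ρ) :
    |(h ^ finrank ℝ E)⁻¹ * ∫ y, K (h⁻¹ • (x - y)) * g y ∂densityMeasure f|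
      ≤ Λ * B * ∫ u, |K u| := by
  rw [inv_pow_mul_integral_comp_inv_smul_sub_mul hf hf0 hh]
  refine abs_integral_mul_le_of_bounded hK fun u hu => ?_
  have hfu := hfΛ _ (sub_smul_mem_ball hKR hh hhρ hu)
  rw [abs_mul]
  exact mul_le_mul hfu (hg _) (abs_nonneg _) ((abs_nonneg _).trans hfu)

lemma tendsto_integral_comp_inv_smul_sub_mul (hf : Measurable f) (hf0 : ∀ x, 0 ≤ f x)
    (hfx : ContinuousAt f x) (hK : Continuous K) (hKc : HasCompactSupport K)
    (hF : ∀ h > 0, Measurable (F h)) (hFB : ∀ h > 0, ∀ y, |F h y| ≤ B) {F₀ : E → ℝ}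
    (hF₀ : ∀ u, Tendsto (fun h => F h (x - h • u)) (𝓝[>] 0) (𝓝 (F₀ u))) :
    Tendsto (fun h => (h ^ finrank ℝ E)⁻¹ * ∫ y, K (h⁻¹ • (x - y)) * F h y ∂densityMeasure f)
      (𝓝[>] 0) (𝓝 (f x * ∫ u, K u * F₀ u)) := by
  obtain ⟨R, -, hKR⟩ := hKc.exists_pos_le_norm
  obtain ⟨Λ, ρ, hρ, hΛ⟩ := exists_thickening_forall_abs_le (isCompact_singleton (x := x)) (f := f)
    (by simpa)
  have hΛ := hΛ x rfl
  have hmove : ∀ u, Tendsto (fun h : ℝ => x - h • u) (𝓝[>] 0) (𝓝 x) := fun u => by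
    have hcont : Continuous fun h : ℝ => x - h • u := by fun_prop
    simpa using (hcont.tendsto 0).mono_left nhdsWithin_le_nhds
  have hsmall : ∀ᶠ h : ℝ in 𝓝[>] 0, h * R ≤ ρ :=
    ((tendsto_id.mul_const R).mono_left nhdsWithin_le_nhds).eventually_le_const (by simpa)
  have hlim := tendsto_integral_mul_of_bounded (hK.integrable_of_hasCompactSupport hKc)
    (μ := volume) (l := 𝓝[>] (0 : ℝ)) (Ψ := fun h u => f (x - h • u) * F h (x - h • u)) (B := Λ * B)
    (eventually_mem_nhdsWithin.mono fun h hh => ?_) ?_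
    (ae_of_all _ fun u => (hfx.tendsto.comp (hmove u)).mul (hF₀ u))
  · simp_rw [mul_left_comm _ (f x), integral_const_mul] at hlim
    refine hlim.congr' (eventually_mem_nhdsWithin.mono fun h hh => ?_)
    exact (inv_pow_mul_integral_comp_inv_smul_sub_mul hf hf0 hh _ _).symm
  · have := hF h hh
    exact (show Measurable _ by fun_prop).aestronglyMeasurable
  · filter_upwards [hsmall, self_mem_nhdsWithin] with h hhρ hh
    refine ae_of_all _ fun u hu => ?_
    have hfu := hΛ _ (sub_smul_mem_ball hKR hh hhρ hu)
    rw [abs_mul]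
    exact mul_le_mul hfu (hFB h hh _) (abs_nonneg _) ((abs_nonneg _).trans hfu)

end Density

end SmoothedLimits

/-! ### Moments of smoothed measures -/

section Moments

variable {E : Type*} [NormedAddCommGroup E] [InnerProductSpace ℝ E] [FiniteDimensional ℝ E]
  [MeasurableSpace E] [BorelSpace E]

/-- The integral over the translates of the subspace `T` of the squared integrals of `K` on them,
written without choosing a complement of `T`. -/
def sliceEnergy (K : E → ℝ) (T : Submodule ℝ E) : ℝ :=
  ∫ u, K u * ∫ z : T, K (z + u)

variable {S : Set E} {σ : Measure E} [IsFiniteMeasure σ] {w f K : E → ℝ}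

lemma continuous_smoothing (hS : IsCompact S) (hσS : ∀ᵐ x ∂σ, x ∈ S) (hw : ContinuousOn w S)
    (hK : Continuous K) (hKc : HasCompactSupport K) (h : ℝ) : Continuous (smoothing σ w K h) := by
  obtain ⟨C, -, hwC⟩ := exists_pos_ae_abs_le hS hσS hw
  obtain ⟨M, hM⟩ := hKc.exists_bound_of_continuous hK
  exact continuous_integral_mul_of_bounded (k := fun x y => K (h⁻¹ • (x - y)))
    (integrable_of_continuousOn hS hσS hw).aestronglyMeasurable hwC
    (by unfold Function.uncurry; fun_prop) fun x y => hM _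

theorem tendsto_integral_smoothing_mul (hS : IsCompact S) (hσS : ∀ᵐ x ∂σ, x ∈ S)
    (hw : ContinuousOn w S) (hf : Measurable f) (hf0 : ∀ x, 0 ≤ f x)
    [IsFiniteMeasure (densityMeasure f)] (hfS : ∀ x ∈ S, ContinuousAt f x) (hK : Continuous K)
    (hKc : HasCompactSupport K) {F : ℝ → E → ℝ} {B : ℝ} (hF : ∀ h > 0, Measurable (F h))
    (hFB : ∀ h > 0, ∀ y, |F h y| ≤ B) {F₀ : E → E → ℝ}
    (hF₀ : ∀ x ∈ S, ∀ u, Tendsto (fun h => F h (x - h • u)) (𝓝[>] 0) (𝓝 (F₀ x u))) :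
    Tendsto (fun h => (h ^ finrank ℝ E)⁻¹ * ∫ y, smoothing σ w K h y * F h y ∂densityMeasure f)
      (𝓝[>] 0) (𝓝 (∫ x, w x * (f x * ∫ u, K u * F₀ x u) ∂σ)) := by
  obtain ⟨C, -, hwC⟩ := exists_pos_ae_abs_le hS hσS hw
  have hwi := integrable_of_continuousOn hS hσS hw
  obtain ⟨M, hM⟩ := hKc.exists_bound_of_continuous hK
  obtain ⟨R, -, hKR⟩ := hKc.exists_pos_le_norm
  obtain ⟨Λ, ρ, hρ, hΛ⟩ := exists_thickening_forall_abs_le hS hfS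
  have hkernel : ∀ h : ℝ, Continuous (Function.uncurry fun x y : E => K (h⁻¹ • (x - y))) :=
    fun h => by unfold Function.uncurry; fun_prop
  have hsmall : ∀ᶠ h : ℝ in 𝓝[>] 0, h * R ≤ ρ :=
    ((tendsto_id.mul_const R).mono_left nhdsWithin_le_nhds).eventually_le_const (by simpa)
  refine (tendsto_integral_mul_of_bounded (B := Λ * B * ∫ u, |K u|)
    (Ψ := fun h x => (h ^ finrank ℝ E)⁻¹ *
      ∫ y, K (h⁻¹ • (x - y)) * F h y ∂densityMeasure f) hwi ?_ ?_
    (hσS.mono fun x hx => tendsto_integral_comp_inv_smul_sub_mul hf hf0 (hfS x hx) hK hKc hF hFB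
      (hF₀ x hx))).congr' ?_
  · filter_upwards [self_mem_nhdsWithin] with h hh
    simp_rw [mul_comm (K _)]
    exact (continuous_const.mul (continuous_integral_mul_of_bounded
      (k := fun y x : E => K (h⁻¹ • (x - y))) (hF h hh).aestronglyMeasurable
      (ae_of_all _ (hFB h hh)) ((hkernel h).comp continuous_swap)
      fun y x => hM _)).aestronglyMeasurable
  · filter_upwards [hsmall, self_mem_nhdsWithin] with h hhρ hh
    filter_upwards [hσS] with x hx _
    exact abs_integral_comp_inv_smul_sub_mul_le hf hf0 (hK.integrable_of_hasCompactSupport hKc)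
      hKR (hΛ x hx) (hFB h hh) hh hhρ
  · filter_upwards [self_mem_nhdsWithin] with h hh
    have hfubini := integral_integral_mul_swap (μ := densityMeasure f) hwi.aestronglyMeasurable
      hwC (hkernel h) (fun x y => hM _) (hF h hh).aestronglyMeasurable (hFB h hh)
    simp_rw [smoothing, hfubini, mul_left_comm (w _), integral_const_mul]

lemma tendsto_integral_smoothing (hS : IsCompact S) (hσS : ∀ᵐ x ∂σ, x ∈ S)
    (hw : ContinuousOn w S) (hf : Measurable f) (hf0 : ∀ x, 0 ≤ f x)
    [IsFiniteMeasure (densityMeasure f)] (hfS : ∀ x ∈ S, ContinuousAt f x) (hK : Continuous K)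
    (hKc : HasCompactSupport K) :
    Tendsto (fun h => (h ^ finrank ℝ E)⁻¹ * ∫ y, smoothing σ w K h y ∂densityMeasure f)
      (𝓝[>] 0) (𝓝 (∫ x, w x * (f x * ∫ u, K u) ∂σ)) := by
  simpa only [mul_one] using tendsto_integral_smoothing_mul hS hσS hw hf hf0 hfS hK hKc
    (F := fun _ _ => 1) (B := 1) (fun _ _ => measurable_const) (fun _ _ _ => by simp)
    (F₀ := fun _ _ => 1) fun _ _ _ => tendsto_const_nhds

section ApproxTangent

variable {T : E → Submodule ℝ E} {A : NNReal} {m : ℕ}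

lemma tendsto_inv_pow_mul_smoothing (hS : IsCompact S) (hσS : ∀ᵐ x ∂σ, x ∈ S)
    (hσ : UpperRegularWith A m σ)
    (hT : ∀ x ∈ S, finrank ℝ (T x) = m ∧ HasApproxTangentAt σ (T x) x)
    (hw : ContinuousOn w S) (hK : Continuous K) (hKc : HasCompactSupport K) {x : E} (hx : x ∈ S)
    (u : E) :
    Tendsto (fun h => (h ^ m)⁻¹ * smoothing σ w K h (x - h • u)) (𝓝[>] 0)
      (𝓝 (w x * ∫ z : T x, K (z + u))) := by
  obtain ⟨rfl, hTx⟩ := hT x hx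
  exact hTx.tendsto_smoothing hσ hσS (integrable_of_continuousOn hS hσS hw) (hw x hx) hK hKc u

lemma integrable_mul_sliceEnergy (hS : IsCompact S) (hσS : ∀ᵐ x ∂σ, x ∈ S)
    (hσ : UpperRegularWith A m σ)
    (hT : ∀ x ∈ S, finrank ℝ (T x) = m ∧ HasApproxTangentAt σ (T x) x)
    (hw : ContinuousOn w S) (hK : Continuous K) (hKc : HasCompactSupport K) :
    Integrable (fun x => w x * sliceEnergy K (T x)) σ := by
  obtain ⟨B, hB⟩ := exists_abs_smoothing_le hS hσS hσ hw hK hKc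
  have hKi : Integrable K := hK.integrable_of_hasCompactSupport hKc
  have hsmooth : ∀ h, Continuous fun z : E × E =>
      K z.2 * ((h ^ m)⁻¹ * smoothing σ w K h (z.1 - h • z.2)) := fun h => by
    have := continuous_smoothing hS hσS hw hK hKc h
    fun_prop
  have hlim : ∀ᵐ x ∂σ,
      Tendsto (fun h => ∫ u, K u * ((h ^ m)⁻¹ * smoothing σ w K h (x - h • u))) (𝓝[>] 0)
        (𝓝 (w x * sliceEnergy K (T x))) := by
    filter_upwards [hσS] with x hx
    rw [sliceEnergy, ← integral_const_mul]
    simp_rw [mul_left_comm (w x)]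
    refine tendsto_integral_mul_of_bounded (B := B) hKi (.of_forall fun h => ?_) ?_
      (ae_of_all _ fun u => tendsto_inv_pow_mul_smoothing hS hσS hσ hT hw hK hKc hx u)
    · have := continuous_smoothing hS hσS hw hK hKc h
      exact Continuous.aestronglyMeasurable (by fun_prop)
    · exact eventually_mem_nhdsWithin.mono fun h hh => ae_of_all _ fun u _ => hB h hh _
  refine .of_bound (aestronglyMeasurable_of_tendsto_ae (𝓝[>] (0 : ℝ)) (fun h =>
    (StronglyMeasurable.integral_prod_right' (hsmooth h).stronglyMeasurable).aestronglyMeasurable)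
    hlim) (B * ∫ u, |K u|) (hlim.mono fun x hx => le_of_tendsto hx.norm ?_)
  exact eventually_mem_nhdsWithin.mono fun h hh =>
    abs_integral_mul_le_of_bounded hKi fun u _ => hB h hh _

theorem tendsto_integral_smoothing_sq (hS : IsCompact S) (hσS : ∀ᵐ x ∂σ, x ∈ S)
    (hσ : UpperRegularWith A m σ)
    (hT : ∀ x ∈ S, finrank ℝ (T x) = m ∧ HasApproxTangentAt σ (T x) x)
    (hw : ContinuousOn w S) (hf : Measurable f) (hf0 : ∀ x, 0 ≤ f x)
    [IsFiniteMeasure (densityMeasure f)] (hfS : ∀ x ∈ S, ContinuousAt f x) (hK : Continuous K)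
    (hKc : HasCompactSupport K) :
    Tendsto (fun h => (h ^ (m + finrank ℝ E))⁻¹ *
        ∫ y, smoothing σ w K h y ^ 2 ∂densityMeasure f)
      (𝓝[>] 0) (𝓝 (∫ x, w x ^ 2 * f x * sliceEnergy K (T x) ∂σ)) := by
  obtain ⟨B, hB⟩ := exists_abs_smoothing_le hS hσS hσ hw hK hKc
  have hlim := tendsto_integral_smoothing_mul hS hσS hw hf hf0 hfS hK hKc
    (F := fun h y => (h ^ m)⁻¹ * smoothing σ w K h y)
    (fun h _ => (continuous_const.mul (continuous_smoothing hS hσS hw hK hKc h)).measurable) hB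
    fun x hx u => tendsto_inv_pow_mul_smoothing hS hσS hσ hT hw hK hKc hx u
  have hlimit : ∀ x, w x * (f x * ∫ u, K u * (w x * ∫ z : T x, K (z + u)))
      = w x ^ 2 * f x * sliceEnergy K (T x) := fun x => by
    simp_rw [mul_left_comm (K _), integral_const_mul, sliceEnergy]
    ring
  simp_rw [hlimit] at hlim
  refine hlim.congr fun h => ?_
  simp_rw [mul_left_comm (smoothing σ w K h _), integral_const_mul, pow_add, mul_inv, ← sq,
    mul_assoc, mul_left_comm ((h ^ m)⁻¹)]

end ApproxTangent

end Moments

/-! ### The central limit theorem in positive codimension -/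

section Codimension

variable {E : Type*} [NormedAddCommGroup E] [InnerProductSpace ℝ E] [FiniteDimensional ℝ E]
  [MeasurableSpace E] [BorelSpace E] {S : Set E} {σ : Measure E} [IsFiniteMeasure σ]
  {w f K : E → ℝ} {T : E → Submodule ℝ E} {A : NNReal} {m k : ℕ}
  [IsProbabilityMeasure (densityMeasure f)]

theorem tendsto_variance_smoothing (hS : IsCompact S) (hσS : ∀ᵐ x ∂σ, x ∈ S)
    (hσ : UpperRegularWith A m σ)
    (hT : ∀ x ∈ S, finrank ℝ (T x) = m ∧ HasApproxTangentAt σ (T x) x)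
    (hk : k ≠ 0) (hmk : m + k = finrank ℝ E) (hw : ContinuousOn w S) (hf : Measurable f)
    (hf0 : ∀ x, 0 ≤ f x) (hfS : ∀ x ∈ S, ContinuousAt f x) (hK : Continuous K)
    (hKc : HasCompactSupport K) :
    Tendsto (fun h => (h ^ (m + finrank ℝ E))⁻¹ * Var[smoothing σ w K h; densityMeasure f])
      (𝓝[>] 0) (𝓝 (∫ x, w x ^ 2 * f x * sliceEnergy K (T x) ∂σ)) := by
  have hpow : Tendsto (fun h : ℝ => h ^ k) (𝓝[>] 0) (𝓝 0) := by
    simpa [hk] using ((continuous_pow k).tendsto (0 : ℝ)).mono_left nhdsWithin_le_nhds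
  have hmean : Tendsto (fun h =>
      h ^ k * ((h ^ finrank ℝ E)⁻¹ * ∫ y, smoothing σ w K h y ∂densityMeasure f) ^ 2)
      (𝓝[>] 0) (𝓝 0) := by
    simpa only [zero_mul] using
      hpow.mul ((tendsto_integral_smoothing hS hσS hw hf hf0 hfS hK hKc).pow 2)
  rw [← sub_zero (∫ x, _ ∂σ)]
  refine ((tendsto_integral_smoothing_sq hS hσS hσ hT hw hf hf0 hfS hK hKc).sub hmean).congr' ?_
  obtain ⟨B, hB⟩ := exists_abs_smoothing_le hS hσS hσ hw hK hKc
  filter_upwards [self_mem_nhdsWithin] with h (hh : 0 < h)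
  have hLp : MemLp (smoothing σ w K h) 2 (densityMeasure f) :=
    .of_bound (continuous_smoothing hS hσS hw hK hKc h).aestronglyMeasurable (h ^ m * B)
      (ae_of_all _ fun y => by
        have := hB h hh y
        rwa [abs_mul, abs_of_pos (by positivity), inv_mul_le_iff₀ (by positivity)] at this)
  rw [variance_eq_sub hLp, mul_sub, ← hmk]
  simp only [Pi.pow_apply]
  congr 1
  field_simp
  ring

variable {Ω : Type*} [MeasurableSpace Ω] {P : Measure Ω} [IsProbabilityMeasure P] {X : ℕ → Ω → E}

theorem tendstoInDistribution_sum_smoothing (hS : IsCompact S) (hσS : ∀ᵐ x ∂σ, x ∈ S)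
    (hσ : UpperRegularWith A m σ)
    (hT : ∀ x ∈ S, finrank ℝ (T x) = m ∧ HasApproxTangentAt σ (T x) x)
    (hk : k ≠ 0) (hmk : m + k = finrank ℝ E) (hw : ContinuousOn w S) (hf : Measurable f)
    (hf0 : ∀ x, 0 ≤ f x) (hfS : ∀ x ∈ S, ContinuousAt f x) (hK : Continuous K)
    (hKc : HasCompactSupport K) (hX : iIndepFun X P) (hlaw : ∀ i, HasLaw (X i) (densityMeasure f) P)
    {h : ℕ → ℝ} (hh : Tendsto h atTop (𝓝[>] 0))
    (hnh : Tendsto (fun n : ℕ => n * h n ^ k) atTop atTop) :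
    TendstoInDistribution (fun (n : ℕ) ω => √(n * h n ^ k) / (n * h n ^ finrank ℝ E) *
        ∑ i ∈ Finset.range n, (smoothing σ w K (h n) (X i ω) -
          ∫ y, smoothing σ w K (h n) y ∂densityMeasure f))
      atTop id (fun _ => P)
      (gaussianReal 0 (∫ x, w x ^ 2 * f x * sliceEnergy K (T x) ∂σ).toNNReal) := by
  obtain ⟨B, hB⟩ := exists_abs_smoothing_le hS hσS hσ hw hK hKc
  have hsize : ∀ᶠ n : ℕ in atTop, 0 < (n : ℝ) ∧ 0 < h n :=
    (tendsto_natCast_atTop_atTop.eventually_gt_atTop 0).and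
      (hh.eventually eventually_mem_nhdsWithin)
  have hclt := tendstoInDistribution_sum_sub_integral_of_bounded hX hlaw
    (g := fun n y => √(n * h n ^ k) / (n * h n ^ finrank ℝ E) * smoothing σ w K (h n) y)
    (a := fun n => (√(n * h n ^ k))⁻¹ * B)
    (fun n => (continuous_const.mul (continuous_smoothing hS hσS hw hK hKc _)).measurable)
    ?_ ?_ (v := ∫ x, w x ^ 2 * f x * sliceEnergy K (T x) ∂σ) ?_
  · simpa only [integral_const_mul, ← mul_sub, ← Finset.mul_sum] using hclt
  · simpa using (Real.tendsto_sqrt_atTop.comp hnh).inv_tendsto_atTop.mul_const B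
  · filter_upwards [hsize] with n ⟨hn, hhn⟩ y
    have hcoeff : √(n * h n ^ k) / (n * h n ^ finrank ℝ E)
        = (√(n * h n ^ k))⁻¹ * (h n ^ m)⁻¹ := by
      rw [← hmk]
      field_simp
      rw [Real.sq_sqrt (by positivity)]
      ring
    rw [hcoeff, mul_assoc, abs_mul, abs_of_pos (by positivity)]
    exact mul_le_mul_of_nonneg_left (hB _ hhn y) (by positivity)
  · refine ((tendsto_variance_smoothing hS hσS hσ hT hk hmk hw hf hf0 hfS hK hKc).comp hh).congr' ?_
    filter_upwards [hsize] with n ⟨hn, hhn⟩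
    rw [variance_const_mul, div_pow, Real.sq_sqrt (by positivity), Function.comp_apply, ← hmk]
    field_simp
    ring

end Codimension

/-! ### Slicing along orthogonal complements -/

section Slicing

variable {E : Type*} [NormedAddCommGroup E] [InnerProductSpace ℝ E] [FiniteDimensional ℝ E]

lemma hasCompactSupport_comp_add_orthogonal (V : Submodule ℝ E) {K : E → ℝ}
    (hKc : HasCompactSupport K) : HasCompactSupport fun q : V × Vᗮ => K (q.1 + q.2) := by
  have h := (hKc.comp_homeomorph V.orthogonalDecomposition.symm.toHomeomorph).comp_homeomorph
    (WithLp.homeomorphProd 2 V Vᗮ).symm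
  convert! h using 2

variable [MeasurableSpace E] [BorelSpace E]

lemma integral_eq_integral_add_orthogonal (V : Submodule ℝ E) (g : E → ℝ) :
    ∫ u, g u = ∫ q : V × Vᗮ, g (q.1 + q.2) := by
  have hmp := (V.measurePreserving_measurableEquivProd (0 : E)).symm
  rw [InnerProductSpace.euclideanHausdorffMeasure_eq_volume] at hmp
  simp only [← hmp.integral_comp', Submodule.measurableEquivProd_symm_apply, vadd_eq_add, add_zero]

theorem sliceEnergy_orthogonal (V : Submodule ℝ E) {K : E → ℝ} (hK : Continuous K)
    (hKc : HasCompactSupport K) :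
    sliceEnergy K Vᗮ = ∫ v : V, (∫ z : Vᗮ, K (z + v)) ^ 2 := by
  have hsupp := hasCompactSupport_comp_add_orthogonal V hKc
  have hslice : Continuous fun v : V => ∫ z : Vᗮ, K (z + v) := by
    refine continuousOn_univ.1 (continuousOn_integral_of_compact_support
      (hsupp.image continuous_snd) (by unfold Function.uncurry; fun_prop) fun v z _ hz => ?_)
    contrapose! hz
    exact ⟨(v, z), subset_tsupport _ (by simpa [add_comm] using hz), rfl⟩
  have htranslate : ∀ q : V × Vᗮ, ∫ z : Vᗮ, K (z + (q.1 + q.2)) = ∫ z : Vᗮ, K (z + q.1) :=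
    fun q => by
      rw [← integral_add_right_eq_self (fun z : Vᗮ => K (z + q.1)) q.2]
      simp only [Submodule.coe_add, add_assoc, add_comm (q.2 : E)]
  have hint : Integrable fun q : V × Vᗮ => K (q.1 + q.2) * ∫ z : Vᗮ, K (z + q.1) :=
    ((hK.comp (by fun_prop)).mul
      (hslice.comp continuous_fst)).integrable_of_hasCompactSupport hsupp.mul_right
  simp_rw [sliceEnergy, integral_eq_integral_add_orthogonal V fun u => K u * _, htranslate,
    Measure.volume_eq_prod]
  rw [integral_prod _ hint]
  simp_rw [integral_mul_const, sq, add_comm (_ : E)]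

end Slicing

/-! ### Level sets -/

lemma integral_span_singleton {E : Type*} [NormedAddCommGroup E] [InnerProductSpace ℝ E]
    [MeasurableSpace E] [BorelSpace E] {N : E} (hN : ‖N‖ = 1) (g : E → ℝ) :
    ∫ v : ℝ ∙ N, g v = ∫ t : ℝ, g (t • N) :=
  ((LinearIsometryEquiv.toSpanUnitSingleton (𝕜 := ℝ) N hN).measurePreserving.integral_comp'
    (f := (LinearIsometryEquiv.toSpanUnitSingleton N hN).toMeasurableEquiv) fun v => g v).symm

lemma setIntegral_image_add {E : Type*} [NormedAddCommGroup E] [InnerProductSpace ℝ E]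
    [FiniteDimensional ℝ E] [MeasurableSpace E] [BorelSpace E] (T : Submodule ℝ E) (v : E)
    (g : E → ℝ) :
    ∫ u in (fun y => y + v) '' (T : Set E), g u ∂μHE[Module.finrank ℝ T]
      = ∫ z : T, g (z + v) := by
  have hiso : Isometry fun y : T => (y : E) + v :=
    (isometry_add_right v).comp isometry_subtype_coe
  have hrange : (fun y => y + v) '' (T : Set E) = Set.range fun y : T => (y : E) + v :=
    Set.image_eq_range _ _
  rw [hrange, ← hiso.map_euclideanHausdorffMeasure,
    hiso.isClosedEmbedding.measurableEmbedding.integral_map,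
    InnerProductSpace.euclideanHausdorffMeasure_eq_volume]

section LevelSet

variable {d : ℕ} {f K : Eucl d → ℝ} {x : Eucl d}

lemma ker_fderiv_eq_tangentSpace (f : Eucl d → ℝ) (x : Eucl d) :
    (fderiv ℝ f x).ker = tangentSpace f x := by
  ext y
  rw [tangentSpace, Submodule.mem_orthogonal_singleton_iff_inner_right, inner_gradient_left]
  rfl

lemma finrank_tangentSpace (hx : gradient f x ≠ 0) :
    Module.finrank ℝ (tangentSpace f x) = d - 1 := by
  have h := (ℝ ∙ gradient f x).finrank_add_finrank_orthogonal
  rw [finrank_span_singleton hx, finrank_euclideanSpace_fin] at h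
  rw [tangentSpace]
  omega

lemma isTangentAt_levelSet {c : ℝ} (hf : HasStrictFDerivAt f (fderiv ℝ f x) x)
    (hgrad : gradient f x ≠ 0) (hx : x ∈ levelSet f c) :
    IsTangentAt (levelSet f c) (tangentSpace f x) x := by
  rw [← ker_fderiv_eq_tangentSpace, levelSet, ← show f x = c from hx]
  refine isTangentAt_preimage hf (LinearMap.surjective fun hzero => hgrad ?_)
  rw [gradient, show fderiv ℝ f x = 0 from ContinuousLinearMap.coe_injective hzero, map_zero]

theorem sliceEnergy_tangentSpace (hx : gradient f x ≠ 0) (hK : Continuous K)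
    (hKc : HasCompactSupport K) : sliceEnergy K (tangentSpace f x) = roughness f K x := by
  have hN : ‖unitNormal f x‖ = 1 := norm_smul_inv_norm hx
  have hspan : tangentSpace f x = (ℝ ∙ unitNormal f x)ᗮ := by
    rw [tangentSpace, unitNormal, Submodule.span_singleton_smul_eq
      (IsUnit.mk0 _ (inv_ne_zero (norm_ne_zero_iff.2 hx)))]
  simp_rw [roughness, tangentPlane, ← finrank_tangentSpace hx, setIntegral_image_add]
  rw [hspan, sliceEnergy_orthogonal _ hK hKc,
    integral_span_singleton hN fun v => (∫ z : (ℝ ∙ unitNormal f x)ᗮ, K (z + v)) ^ 2]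

end LevelSet

/-! ### The kernel density estimator -/

section CentredKernel

variable {E : Type*} [NormedAddCommGroup E] [NormedSpace ℝ E] [MeasurableSpace E] [BorelSpace E]
  {σ μ : Measure E} [IsFiniteMeasure σ] {w K : E → ℝ} {C M : ℝ}

lemma integrable_mul_comp_inv_smul_sub (hw : AEStronglyMeasurable w σ)
    (hwC : ∀ᵐ x ∂σ, |w x| ≤ C) (hK : Continuous K) (hKM : ∀ z, |K z| ≤ M) (h : ℝ) (y : E) :
    Integrable (fun x => w x * K (h⁻¹ • (x - y))) σ :=
  (Integrable.of_bound hw C hwC).mul_bdd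
    (Continuous.aestronglyMeasurable (by fun_prop)) (ae_of_all _ fun _ => hKM _)

variable [SecondCountableTopology E] [IsFiniteMeasure μ]

lemma integrable_mul_integral_comp_inv_smul_sub (hw : AEStronglyMeasurable w σ)
    (hwC : ∀ᵐ x ∂σ, |w x| ≤ C) (hK : Continuous K) (hKM : ∀ z, |K z| ≤ M) (h : ℝ) :
    Integrable (fun x => w x * ∫ y, K (h⁻¹ • (x - y)) ∂μ) σ :=
  (Integrable.of_bound hw C hwC).mul_bdd
    (StronglyMeasurable.integral_prod_right' (f := fun z : E × E => K (h⁻¹ • (z.1 - z.2)))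
      (Continuous.stronglyMeasurable (by fun_prop))).aestronglyMeasurable
    (ae_of_all _ fun _ => norm_integral_le_of_norm_le_const (ae_of_all _ fun _ => hKM _))

lemma integral_mul_sub_integral_comp_inv_smul_sub (hw : AEStronglyMeasurable w σ)
    (hwC : ∀ᵐ x ∂σ, |w x| ≤ C) (hK : Continuous K) (hKM : ∀ z, |K z| ≤ M) (h : ℝ) (y : E) :
    ∫ x, w x * (K (h⁻¹ • (x - y)) - ∫ z, K (h⁻¹ • (x - z)) ∂μ) ∂σ
      = smoothing σ w K h y - ∫ z, smoothing σ w K h z ∂μ := by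
  have hswap := integral_integral_mul_swap (μ := μ) (g := fun _ => 1) hw hwC
    (k := fun x y => K (h⁻¹ • (x - y))) (by unfold Function.uncurry; fun_prop)
    (fun _ _ => hKM _) aestronglyMeasurable_const (fun _ => abs_one.le)
  simp only [mul_one] at hswap
  simp_rw [smoothing, hswap, mul_sub]
  exact integral_sub (integrable_mul_comp_inv_smul_sub hw hwC hK hKM h y)
    (integrable_mul_integral_comp_inv_smul_sub hw hwC hK hKM h)

end CentredKernel

section KDE

variable {d : ℕ} {Ω : Type*} [MeasurableSpace Ω] {P : Measure Ω} [IsFiniteMeasure P]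
  {μ σ : Measure (Eucl d)} {X : ℕ → Ω → Eucl d} {K w : Eucl d → ℝ} {C M : ℝ}

lemma mul_kde_sub_integral_kde (hlaw : ∀ i, HasLaw (X i) μ P) (hK : Continuous K)
    (hKM : ∀ z, |K z| ≤ M) (a : ℝ) (n : ℕ) (h : ℝ) (x : Eucl d) (ω : Ω) :
    a * (kde K X n h x ω - ∫ ω', kde K X n h x ω' ∂P)
      = 1 / (n * h ^ d) * ∑ i ∈ Finset.range n,
        a * (K (h⁻¹ • (x - X i ω)) - ∫ y, K (h⁻¹ • (x - y)) ∂μ) := by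
  have hshift : Continuous fun y => K (h⁻¹ • (x - y)) := by fun_prop
  have hint : ∀ i, Integrable (fun ω' => K (h⁻¹ • (x - X i ω'))) P := fun i =>
    .of_bound (hshift.measurable.comp_aemeasurable (hlaw i).aemeasurable).aestronglyMeasurable M
      (ae_of_all _ fun _ => hKM _)
  have hmean : ∀ i, ∫ ω', K (h⁻¹ • (x - X i ω')) ∂P = ∫ y, K (h⁻¹ • (x - y)) ∂μ := fun i =>
    (hlaw i).integral_comp (f := fun y => K (h⁻¹ • (x - y))) hshift.aestronglyMeasurable
  simp_rw [kde, integral_const_mul, integral_finsetSum _ fun i _ => hint i, hmean, ← mul_sub,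
    ← Finset.sum_sub_distrib, ← Finset.mul_sum, mul_left_comm a]

variable [IsFiniteMeasure σ] [IsFiniteMeasure μ]

lemma integrable_mul_kde_sub_integral_kde (hlaw : ∀ i, HasLaw (X i) μ P)
    (hw : AEStronglyMeasurable w σ) (hwC : ∀ᵐ x ∂σ, |w x| ≤ C) (hK : Continuous K)
    (hKM : ∀ z, |K z| ≤ M) (n : ℕ) (h : ℝ) (ω : Ω) :
    Integrable (fun x => w x * (kde K X n h x ω - ∫ ω', kde K X n h x ω' ∂P)) σ := by
  simp_rw [mul_kde_sub_integral_kde hlaw hK hKM, mul_sub]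
  exact (integrable_finsetSum _ fun i _ => (integrable_mul_comp_inv_smul_sub hw hwC hK hKM h _).sub
    (integrable_mul_integral_comp_inv_smul_sub hw hwC hK hKM h)).const_mul _

theorem integral_mul_kde_sub_integral_kde (hlaw : ∀ i, HasLaw (X i) μ P)
    (hw : AEStronglyMeasurable w σ) (hwC : ∀ᵐ x ∂σ, |w x| ≤ C) (hK : Continuous K)
    (hKM : ∀ z, |K z| ≤ M) (n : ℕ) (h : ℝ) (ω : Ω) :
    ∫ x, w x * (kde K X n h x ω - ∫ ω', kde K X n h x ω' ∂P) ∂σ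
      = 1 / (n * h ^ d) * ∑ i ∈ Finset.range n,
        (smoothing σ w K h (X i ω) - ∫ y, smoothing σ w K h y ∂μ) := by
  simp_rw [mul_kde_sub_integral_kde hlaw hK hKM, integral_const_mul]
  rw [integral_finsetSum]
  · simp_rw [integral_mul_sub_integral_comp_inv_smul_sub hw hwC hK hKM]
  · simp_rw [mul_sub]
    exact fun i _ => (integrable_mul_comp_inv_smul_sub hw hwC hK hKM h _).sub
      (integrable_mul_integral_comp_inv_smul_sub hw hwC hK hKM h)

end KDE

section RegularLevelSet

variable {d : ℕ} {f w K : Eucl d → ℝ} {c : ℝ} {ν : ℕ}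

lemma DensitySmoothness.hasStrictFDerivAt_and_gradient_ne_zero (hf : DensitySmoothness f c ν)
    (hν : ν ≠ 0) {x : Eucl d} (hx : x ∈ levelSet f c) :
    HasStrictFDerivAt f (fderiv ℝ f x) x ∧ gradient f x ≠ 0 := by
  obtain ⟨δ₀, hδ₀, ε₀, hε₀, hreg⟩ := hf
  have hband : x ∈ levelBand f c (2 * δ₀) := by
    rw [levelBand, Set.mem_preimage, show f x = c from hx]
    constructor <;> linarith
  exact ⟨(hreg x hband).1.hasStrictFDerivAt (by exact_mod_cast hν),
    norm_pos_iff.1 (hε₀.trans (hreg x hband).2)⟩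

lemma exists_upperRegularWith_levelSet (hM : IsCompact (levelSet f c))
    (hreg : ∀ x ∈ levelSet f c, HasStrictFDerivAt f (fderiv ℝ f x) x ∧ gradient f x ≠ 0) :
    ∃ A, UpperRegularWith A (d - 1) (μHE[d - 1].restrict (levelSet f c)) :=
  exists_upperRegularWith_of_isTangentAt hM fun x hx =>
    ⟨tangentSpace f x, finrank_tangentSpace (hreg x hx).2,
      isTangentAt_levelSet (hreg x hx).1 (hreg x hx).2 hx⟩

lemma isFiniteMeasure_restrict_levelSet (hM : IsCompact (levelSet f c))
    (hreg : ∀ x ∈ levelSet f c, HasStrictFDerivAt f (fderiv ℝ f x) x ∧ gradient f x ≠ 0) :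
    IsFiniteMeasure (μHE[d - 1].restrict (levelSet f c)) := by
  obtain ⟨A, hA⟩ := exists_upperRegularWith_levelSet hM hreg
  refine ⟨?_⟩
  simpa only [Measure.restrict_apply_univ, Measure.restrict_apply_self]
    using hA.measure_lt_top_of_isBounded hM.isBounded

lemma hasApproxTangentAt_levelSet (hM : IsCompact (levelSet f c))
    (hreg : ∀ x ∈ levelSet f c, HasStrictFDerivAt f (fderiv ℝ f x) x ∧ gradient f x ≠ 0)
    {x : Eucl d} (hx : x ∈ levelSet f c) :
    HasApproxTangentAt (μHE[d - 1].restrict (levelSet f c)) (tangentSpace f x) x := by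
  obtain ⟨A, hA⟩ := exists_upperRegularWith_levelSet hM hreg
  have hdim := finrank_tangentSpace (hreg x hx).2
  simpa only [hdim] using hasApproxTangentAt_of_isTangentAt (T := tangentSpace f x)
    hM.measurableSet (hdim.symm ▸ hA) hx (isTangentAt_levelSet (hreg x hx).1 (hreg x hx).2 hx)

lemma integrableOn_sq_mul_roughness (hM : IsCompact (levelSet f c))
    (hreg : ∀ x ∈ levelSet f c, HasStrictFDerivAt f (fderiv ℝ f x) x ∧ gradient f x ≠ 0)
    (hw : ContinuousOn w (levelSet f c)) (hK : Continuous K) (hKc : HasCompactSupport K) :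
    IntegrableOn (fun x => w x ^ 2 * roughness f K x) (levelSet f c) μHE[d - 1] := by
  obtain ⟨A, hA⟩ := exists_upperRegularWith_levelSet hM hreg
  have : IsFiniteMeasure (μHE[d - 1].restrict (levelSet f c)) :=
    isFiniteMeasure_restrict_levelSet hM hreg
  have hslice := integrable_mul_sliceEnergy hM (ae_restrict_mem hM.measurableSet) hA
    (fun x hx => ⟨finrank_tangentSpace (hreg x hx).2, hasApproxTangentAt_levelSet hM hreg hx⟩)
    (hw.pow 2) hK hKc
  refine (integrableOn_congr_fun (fun x hx => ?_) hM.measurableSet).1 hslice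
  simp only [Pi.pow_apply, sliceEnergy_tangentSpace (hreg x hx).2 hK hKc]

lemma setIntegral_mul_mul_sliceEnergy_tangentSpace (hM : MeasurableSet (levelSet f c))
    (hgrad : ∀ x ∈ levelSet f c, gradient f x ≠ 0) (hK : Continuous K) (hKc : HasCompactSupport K)
    (g : Eucl d → ℝ) :
    ∫ x in levelSet f c, g x * f x * sliceEnergy K (tangentSpace f x) ∂μHE[d - 1]
      = c * surfaceIntegral f c fun x => g x * roughness f K x := by
  rw [surfaceIntegral, ← integral_const_mul]
  refine setIntegral_congr_fun hM fun x hx => ?_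
  have hfx : f x = c := hx
  simp only [sliceEnergy_tangentSpace (hgrad x hx) hK hKc, hfx]
  ring

end RegularLevelSet

lemma mul_surfaceIntegral_sq_mul_roughness_nonneg {d : ℕ} {f : Eucl d → ℝ} (hf : ∀ x, 0 ≤ f x)
    (c : ℝ) (w K : Eucl d → ℝ) :
    0 ≤ c * surfaceIntegral f c fun x => w x ^ 2 * roughness f K x := by
  rcases (levelSet f c).eq_empty_or_nonempty with hempty | ⟨x, hx⟩
  · simp only [surfaceIntegral, hempty, setIntegral_empty, mul_zero, le_refl]
  · exact mul_nonneg ((hf x).trans_eq hx) <| integral_nonneg fun y =>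
      mul_nonneg (sq_nonneg _) (integral_nonneg fun t => sq_nonneg _)

end LevelSetKDE

end

open LevelSetKDE in
theorem mainTheorem5_general {d : ℕ} (hd : 0 < d)
    {Ω : Type*} [MeasurableSpace Ω] (P : Measure Ω) [IsProbabilityMeasure P]
    (f : Eucl d → ℝ) (hf_meas : Measurable f) (hf_nonneg : ∀ x, 0 ≤ f x)
    (X : ℕ → Ω → Eucl d) (hX_indep : iIndepFun X P)
    (hX_law : ∀ i, HasLaw (X i) (volume.withDensity fun x => ENNReal.ofReal (f x)) P)
    (c : ℝ) (K : Eucl d → ℝ) (hK : Continuous K) (hKc : HasCompactSupport K)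
    (hM : IsCompact (levelSet f c))
    (hreg : ∀ x ∈ levelSet f c, HasStrictFDerivAt f (fderiv ℝ f x) x ∧ gradient f x ≠ 0)
    (w : Eucl d → ℝ) (hw : ContinuousOn w (levelSet f c)) (h : ℕ → ℝ)
    (hnh : Tendsto (fun n : ℕ => n * h n) atTop atTop) (hh : Tendsto h atTop (𝓝 0)) :
    IntegrableOn (fun x => w x ^ 2 * roughness f K x) (levelSet f c) μHE[d - 1] ∧
    0 ≤ c * surfaceIntegral f c (fun x => w x ^ 2 * roughness f K x) ∧
    (∀ n ω, IntegrableOn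
      (fun x => w x * (kde K X n (h n) x ω - ∫ ω', kde K X n (h n) x ω' ∂P))
      (levelSet f c) μHE[d - 1]) ∧
    TendstoInDistribution
      (fun (n : ℕ) (ω : Ω) => √(n * h n) * surfaceIntegral f c
        (fun x => w x * (kde K X n (h n) x ω - ∫ ω', kde K X n (h n) x ω' ∂P)))
      atTop id (fun _ => P)
      (gaussianReal 0
        (c * surfaceIntegral f c (fun x => w x ^ 2 * roughness f K x)).toNNReal) := by
  have : IsProbabilityMeasure (densityMeasure f) :=
    (hX_law 0).isProbabilityMeasure_iff.1 ‹_›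
  have := isFiniteMeasure_restrict_levelSet hM hreg
  obtain ⟨A, hA⟩ := exists_upperRegularWith_levelSet hM hreg
  have hσ := ae_restrict_mem (μ := μHE[d - 1]) hM.measurableSet
  have hw_meas := aestronglyMeasurable_of_continuousOn hM.measurableSet hσ hw
  obtain ⟨C, -, hwC⟩ := exists_pos_ae_abs_le hM hσ hw
  obtain ⟨B, hKB⟩ := hKc.exists_bound_of_continuous hK
  have hh_pos : ∀ᶠ n in atTop, 0 < h n :=
    (hnh.eventually_gt_atTop 0).mono fun n hn => pos_of_mul_pos_right hn n.cast_nonneg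
  refine ⟨integrableOn_sq_mul_roughness hM hreg hw hK hKc,
    mul_surfaceIntegral_sq_mul_roughness_nonneg hf_nonneg c w K,
    fun n => integrable_mul_kde_sub_integral_kde hX_law hw_meas hwC hK hKB n (h n), ?_⟩
  have hclt := tendstoInDistribution_sum_smoothing hM hσ hA
    (fun x hx => ⟨finrank_tangentSpace (hreg x hx).2, hasApproxTangentAt_levelSet hM hreg hx⟩)
    one_ne_zero (by rw [finrank_euclideanSpace_fin]; omega) hw hf_meas hf_nonneg
    (fun x hx => (hreg x hx).1.continuousAt) hK hKc hX_indep hX_law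
    (tendsto_nhdsWithin_iff.2 ⟨hh, hh_pos⟩) (by simpa only [pow_one] using hnh)
  rw [setIntegral_mul_mul_sliceEnergy_tangentSpace hM.measurableSet (fun x hx => (hreg x hx).2)
    hK hKc] at hclt
  simpa only [surfaceIntegral, integral_mul_kde_sub_integral_kde hX_law hw_meas hwC hK hKB,
    finrank_euclideanSpace_fin, pow_one, ← mul_assoc, mul_one_div] using hclt

open LevelSetKDE in
theorem mainTheorem5 {d : ℕ} (hd : 2 ≤ d)
    {Ω : Type*} [MeasurableSpace Ω] (P : Measure Ω) [IsProbabilityMeasure P]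
    (f : Eucl d → ℝ) (hf_meas : Measurable f) (hf_nonneg : ∀ x, 0 ≤ f x)
    (X : ℕ → Ω → Eucl d) (hX_indep : iIndepFun X P)
    (hX_law : ∀ i, HasLaw (X i) (volume.withDensity fun x => ENNReal.ofReal (f x)) P)
    (c : ℝ) (ν : ℕ) (K : Eucl d → ℝ)
    (hF1 : DensitySmoothness f c ν) (hM : IsCompact (levelSet f c))
    (hK : KernelAssumption K ν)
    (w : Eucl d → ℝ) (hw_cont : ContinuousOn w (levelSet f c))
    (hw_bdd : ∃ C, ∀ x ∈ levelSet f c, |w x| ≤ C)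
    (h : ℕ → ℝ) (hh_pos : ∀ n, 0 < h n)
    (hnh : Tendsto (fun n : ℕ => n * h n) atTop atTop) (hh : Tendsto h atTop (𝓝 0)) :
    IntegrableOn (fun x => w x ^ 2 * roughness f K x) (levelSet f c) μHE[d - 1] ∧
    0 ≤ c * surfaceIntegral f c (fun x => w x ^ 2 * roughness f K x) ∧
    (∀ n ω, IntegrableOn
      (fun x => w x * (kde K X n (h n) x ω - ∫ ω', kde K X n (h n) x ω' ∂P))
      (levelSet f c) μHE[d - 1]) ∧
    TendstoInDistribution
      (fun (n : ℕ) (ω : Ω) => √(n * h n) * surfaceIntegral f c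
        (fun x => w x * (kde K X n (h n) x ω - ∫ ω', kde K X n (h n) x ω' ∂P)))
      atTop id (fun _ => P)
      (gaussianReal 0
        (c * surfaceIntegral f c (fun x => w x ^ 2 * roughness f K x)).toNNReal) := by
  exact mainTheorem5_general (by omega) P f hf_meas hf_nonneg X hX_indep hX_law c K
    hK.contDiff.continuous hK.hasCompactSupport hM
    (fun _ => hF1.hasStrictFDerivAt_and_gradient_ne_zero (by have := hK.two_le_order; omega))
    w hw_cont h hnh hh
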